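/- **Proposition 3.1.** Let $a,b,\varepsilon>0$ and $0<\theta<\pi/2$. For $n\ge 1$ put $$a_{n,i}=\frac{a+(i-1)\varepsilon/n}{n},\qquad b_n=\frac bn,\qquad \varepsilon_n=\frac{\varepsilon}{n^2},\qquad d_n^{\ell}=\frac{\varepsilon_n}{2\sin\theta},$$ and consider only $n$ so large that $d_n^\ell\cos\theta<b_n$. *The surfaces.* For $1\le i\le n$ let $H_{n,i}:[0,b_n]\to\mathbb R$ be the continuous piecewise affine function that equals $a_{n,i}/2$ on $[0,x_-]$, has slope $\tan\theta$ on $[x_-,x_+]$ and equals $(a_{n,i}+\varepsilon_n)/2$ on $[x_+,b_n]$, where $x_\pm=\tfrac12(b_n\pm d_n^\ell\cos\theta)$. For $1\le i,j\le n$ the block $\tilde{\mathcal M}_n(i,j)$ is obtained from the lower hexagon $\{(X,Y):0\le X\le b_n,\ 0\le Y\le H_{n,i}(X)\}$ and the upper hexagon $\{(X,Y):0\le X\le b_n,\ -H_{n,i}(X)\le Y\le 0\}$ by identifying the point $(X,H_{n,i}(X))$ of the lower one with the point $(X,-H_{n,i}(X))$ of the upper one for all $X$. The surface $\tilde{\mathcal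 M}_n$ is obtained from the $n^2$ blocks by gluing isometrically the top side ($Y=0$ in the upper hexagon) of $\tilde{\mathcal M}_n(i,j)$ to the bottom side ($Y=0$ in the lower hexagon) of $\tilde{\mathcal M}_n(i,j+1)$, by $(X,0)\sim(X,0)$, and the right side of $\tilde{\mathcal M}_n(i,j)$ to the left side of $\tilde{\mathcal M}_n(i+1,j)$, by $(b_n,Y)\sim(0,Y)$ in the lower and in the upper hexagons. Let $d_n$ be the intrinsic distance of $\tilde{\mathcal M}_n$ (infimum of Euclidean lengths of curves), and let $\mathfrak g_n=dX^2+dY^2$, with the orientation of $(X,Y)$, on $\mathcal M_n$, which is $\tilde{\mathcal M}_n$ without the segments over $[x_-,x_+]$ along which the two hexagons of a block are glued. *The limit.* Let $R_0=ab/\varepsilon$, $R_1=R_0+b$, and let $\mathcal N=\{(r,\varphi)\in[R_0,R_1]\times[0,\varepsilon/b]\}$ be the sector of angle $\varepsilon/b$ of the annulus with radii $R_0,R_1$, in polar coordinates, with the Euclidean metric $\mathfrak g=dr^2+r^2d\varphi^2$, its volume $d\mathrm{Vol}_{\mathfrak g}=r\,dr\,d\varphi$, the orientation of $(r,\varphi)$,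 and its intrinsic distance $d$. *The maps.* Let $\Delta\varphi_n=\varepsilon_n/b_n$, $D=\Delta\varphi_n/(2\tan\theta)$, and, for real $s$, $r_s=R_0+(s-1)b_n$ and $\varphi_s=(s-1)\Delta\varphi_n$. For $r\in[r_i,r_{i+1}]$ let $$h_{n,i}(r)=\begin{cases} r_i & r\le r_{i+1/2-D/2},\\ r_i+\frac1D\,(r-r_{i+1/2-D/2}) & r_{i+1/2-D/2}\le r\le r_{i+1/2+D/2},\\ r_{i+1}& r\ge r_{i+1/2+D/2}.\end{cases}$$ The map $F_n:\mathcal N\to\tilde{\mathcal M}_n$ sends $(r,\varphi)\in[r_i,r_{i+1}]\times[\varphi_j,\varphi_{j+1/2}]$ to the point $\big(r-r_i,\ (\varphi-\varphi_j)\,h_{n,i}(r)\big)$ of the lower hexagon of $\tilde{\mathcal M}_n(i,j)$, and $(r,\varphi)\in[r_i,r_{i+1}]\times[\varphi_{j+1/2},\varphi_{j+1}]$ to the point $\big(r-r_i,\ (\varphi-\varphi_{j+1})\,h_{n,i}(r)\big)$ of its upper hexagon. Its differential $dF_n$ is defined almost everywhere. Then, as $n\to\infty$: 1. $\operatorname{dis}F_n=\sup_{x,y\in\mathcal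 N}\big|d(x,y)-d_n(F_n(x),F_n(y))\big|\to 0$. 2. For every $p\in[1,\infty)$, $$\int_{\mathcal N}\operatorname{dist}^p\big(dF_n,SO(\mathfrak g,\mathfrak g_n)\big)\,d\mathrm{Vol}_{\mathfrak g}\to 0,$$ where, at almost every $x\in\mathcal N$, $SO(\mathfrak g,\mathfrak g_n)$ is the set of metric- and orientation-preserving linear maps $T_x\mathcal N\to T_{F_n(x)}\mathcal M_n$, and $\operatorname{dist}$ is taken in the operator norm with respect to $\mathfrak g$ and $\mathfrak g_n$. -/

import Mathlib

open Set Filter Topology MeasureTheory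

noncomputable section

namespace EdgeDislocation

/-! ### Curves and lengths -/

/-- The Euclidean norm of a vector `v` of the plane (`ℝ × ℝ` itself carries the sup norm; only its
topology, its linear structure and its Lebesgue measure are used below): the metric
`dX² + dY²`. -/
def flatNorm (v : ℝ × ℝ) : ℝ := √(v.1 ^ 2 + v.2 ^ 2)

/-- The norm of a tangent vector `v = (v_r, v_φ)` at `x = (r, φ)` in the metric `dr² + r² dφ²`. -/
def polarNorm (x v : ℝ × ℝ) : ℝ := √(v.1 ^ 2 + x.1 ^ 2 * v.2 ^ 2)

/-- There is a `C¹` arc inside `S` from `x` to `y` whose length is `L`, where tangent vectors are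
measured by `nrm`. -/
def IsArc (S : Set (ℝ × ℝ)) (nrm : ℝ × ℝ → ℝ × ℝ → ℝ) (x y : ℝ × ℝ) (L : ℝ) : Prop :=
  ∃ (γ : ℝ → ℝ × ℝ) (s t : ℝ), s ≤ t ∧ ContDiff ℝ 1 γ ∧ (∀ τ ∈ Icc s t, γ τ ∈ S) ∧
    γ s = x ∧ γ t = y ∧ L = ∫ τ in s..t, nrm (γ τ) (deriv γ τ)

/-- `Chain arc p q L`: there is a finite concatenation of arcs from `p` to `q` of total length
`L`. -/
inductive Chain {α : Type} (arc : α → α → ℝ → Prop) : α → α → ℝ → Prop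
  | nil (p : α) : Chain arc p p 0
  | cons {p q r : α} {l L : ℝ} (h : arc p q l) (t : Chain arc q r L) : Chain arc p r (l + L)

/-- The infimum of the lengths of all finite concatenations of arcs from `p` to `q`. -/
def pathDist {α : Type} (arc : α → α → ℝ → Prop) (p q : α) : ℝ := sInf {L | Chain arc p q L}

/-! ### The building block -/

/-- Abscissa of the singular point `p₋` in a block of width `β` and dislocation magnitude `δ`.
The dislocation line has length `d = δ / (2 sin θ)`, and it is centred in the block. -/
def xMinus (β θ δ : ℝ) : ℝ := (β - δ / (2 * Real.sin θ) * Real.cos θ) / 2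

/-- Abscissa of the singular point `p₊`. -/
def xPlus (β θ δ : ℝ) : ℝ := (β + δ / (2 * Real.sin θ) * Real.cos θ) / 2

/-- The height over the abscissa `X` of the broken line `E p₋ p₊ F`, measured from the edge `BC`:
it is `α/2` on `E p₋`, it has slope `tan θ` on `p₋ p₊` and it is `(α + δ)/2` on `p₊ F`. -/
def height (α β θ δ X : ℝ) : ℝ :=
  if X ≤ xMinus β θ δ then α / 2
  else if X ≤ xPlus β θ δ then α / 2 + (X - xMinus β θ δ) * Real.tan θ
  else (α + δ) / 2

/-- The Euclidean hexagons `B C F p₊ p₋ E` (lower, `up = false`, with the edge `BC` on the line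
`Y = 0`) and `A D F p₊ p₋ E` (upper, `up = true`, with the edge `AD` on the line `Y = 0`) that
form the block with sides `α, β, β, α + δ`. -/
def hexagon (α β θ δ : ℝ) (up : Bool) : Set (ℝ × ℝ) :=
  {x | 0 ≤ x.1 ∧ x.1 ≤ β ∧
    if up then -height α β θ δ x.1 ≤ x.2 ∧ x.2 ≤ 0 else 0 ≤ x.2 ∧ x.2 ≤ height α β θ δ x.1}

/-! ### The surfaces with `n²` dislocations -/

/-- The parameters `a, b, ε, θ` of the construction. -/
structure Params where
  a : ℝ
  b : ℝ
  ε : ℝ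
  θ : ℝ
  a_pos : 0 < a
  b_pos : 0 < b
  ε_pos : 0 < ε
  θ_pos : 0 < θ
  θ_lt : θ < Real.pi / 2

namespace Params

variable (P : Params) (n : ℕ+)

/-- Left side of the blocks of the `i`-th column; columns are numbered from `0` to `n - 1`. -/
def aCell (i : ℕ) : ℝ := (P.a + i * P.ε / (n : ℕ)) / (n : ℕ)

/-- Width of every block. -/
def bCell : ℝ := P.b / (n : ℕ)

/-- Dislocation magnitude of every block. -/
def εCell : ℝ := P.ε / ((n : ℕ) : ℝ) ^ 2

end Params

/-- Labels of the `2 n²` hexagons: column, row, and whether it is the upper one of its block. -/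
abbrev Label (n : ℕ+) : Type := Fin n × Fin n × Bool

namespace Params

variable (P : Params) (n : ℕ+)

/-- The hexagon with label `h`. -/
def hex (h : Label n) : Set (ℝ × ℝ) :=
  hexagon (P.aCell n h.1) (P.bCell n) P.θ (P.εCell n) h.2.2

/-- The disjoint union of all hexagons. -/
abbrev Pieces : Type := Σ h : Label n, P.hex n h

/-- The identifications of boundary points of the hexagons. -/
inductive Glue : P.Pieces n → P.Pieces n → Prop
  /-- Inside the block `(i, j)`: the two hexagons are glued along `E p₋ p₊ F`. -/
  | mid (i j : Fin n) (X Y Y' : ℝ)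
      (hY : Y = height (P.aCell n i) (P.bCell n) P.θ (P.εCell n) X) (hY' : Y' = -Y)
      (h : (X, Y) ∈ P.hex n (i, j, false)) (h' : (X, Y') ∈ P.hex n (i, j, true)) :
      Glue ⟨(i, j, false), ⟨(X, Y), h⟩⟩ ⟨(i, j, true), ⟨(X, Y'), h'⟩⟩
  /-- The top side of the block `(i, j)` is glued to the bottom side of the block `(i, j + 1)`. -/
  | vert (i j j' : Fin n) (hj : (j' : ℕ) = j + 1) (X : ℝ)
      (h : (X, 0) ∈ P.hex n (i, j, true)) (h' : (X, 0) ∈ P.hex n (i, j', false)) :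
      Glue ⟨(i, j, true), ⟨(X, 0), h⟩⟩ ⟨(i, j', false), ⟨(X, 0), h'⟩⟩
  /-- The right side of the block `(i, j)` is glued to the left side of the block `(i + 1, j)`. -/
  | horiz (i i' j : Fin n) (hi : (i' : ℕ) = i + 1) (up : Bool) (Y : ℝ)
      (h : (P.bCell n, Y) ∈ P.hex n (i, j, up)) (h' : (0, Y) ∈ P.hex n (i', j, up)) :
      Glue ⟨(i, j, up), ⟨(P.bCell n, Y), h⟩⟩ ⟨(i', j, up), ⟨(0, Y), h'⟩⟩

/-- The surface with `n²` edge-dislocations: the quotient of the disjoint union of the hexagons by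
the equivalence relation generated by the identifications. -/
def Surface : Type := Quot (P.Glue n)

/-- An arc of the surface that runs inside one hexagon. -/
def surfaceArc (p q : P.Surface n) (L : ℝ) : Prop :=
  ∃ (h : Label n) (x y : P.hex n h), Quot.mk _ ⟨h, x⟩ = p ∧ Quot.mk _ ⟨h, y⟩ = q ∧
    IsArc (P.hex n h) (fun _ v => flatNorm v) x y L

/-- The intrinsic distance `d_n` of the surface. -/
def surfaceDist (p q : P.Surface n) : ℝ := pathDist (P.surfaceArc n) p q

/-! ### The limit sector -/

/-- Inner radius. -/
def R₀ : ℝ := P.a * P.b / P.ε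

/-- Outer radius. -/
def R₁ : ℝ := P.R₀ + P.b

/-- The sector in polar coordinates `(r, φ)`. -/
def sector : Set (ℝ × ℝ) := Icc P.R₀ P.R₁ ×ˢ Icc 0 (P.ε / P.b)

/-- The intrinsic distance `d` of the sector, for the metric `dr² + r² dφ²`: the infimum of the
lengths of piecewise `C¹` curves in the sector. -/
def sectorDist (x y : P.sector) : ℝ :=
  pathDist (fun p q : P.sector => IsArc P.sector polarNorm p q) x y

/-- The Riemannian volume `r dr dφ` of the sector. -/
def sectorVol : Measure (ℝ × ℝ) :=
  (volume.restrict P.sector).withDensity fun x => ENNReal.ofReal x.1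

/-! ### The maps `F_n` -/

/-- `r_s = R₀ + s ΔR_n` with `ΔR_n = b_n`, also for non-integral `s`. -/
def rad (s : ℝ) : ℝ := P.R₀ + s * P.bCell n

/-- `Δφ_n = ε_n / b_n`. -/
def dφ : ℝ := P.εCell n / P.bCell n

/-- `φ_s = s Δφ_n`, also for non-integral `s`. -/
def ang (s : ℝ) : ℝ := s * P.dφ n

/-- The relative width of the middle zone of a cell. -/
def D : ℝ := P.dφ n / (2 * Real.tan P.θ)

/-- The factor that multiplies the angle in the second component of `F_n`. -/
def factor (i : ℕ) (r : ℝ) : ℝ :=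
  if r ≤ P.rad n (i + 1 / 2 - P.D n / 2) then P.rad n i
  else if r ≤ P.rad n (i + 1 / 2 + P.D n / 2) then
    P.rad n i + 1 / P.D n * (r - P.rad n (i + 1 / 2 - P.D n / 2))
  else P.rad n (i + 1)

/-- The expression of `F_n` on the half-cell with label `h`, in the polar coordinates `(r, φ)` of
the sector and the Euclidean coordinates `(X, Y)` of the hexagon with the same label. -/
def chartF (h : Label n) (x : ℝ × ℝ) : ℝ × ℝ :=
  (x.1 - P.rad n (h.1 : ℕ),
    (x.2 - if h.2.2 then P.ang n ((h.2.1 : ℕ) + 1) else P.ang n (h.2.1 : ℕ)) *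
      P.factor n h.1 x.1)

/-- The integer part of `t`, cut off at `n - 1`. -/
def idx (n : ℕ+) (t : ℝ) : Fin n :=
  ⟨min ⌊t⌋₊ (n - 1), lt_of_le_of_lt (min_le_right _ _) (Nat.sub_lt n.pos one_pos)⟩

/-- The label of a closed half-cell `[r_i, r_{i+1}] × [φ_j, φ_{j+1/2}]` (lower) or
`[r_i, r_{i+1}] × [φ_{j+1/2}, φ_{j+1}]` (upper) that contains `x`.  Points common to several
half-cells get one of the labels; the images in the surface agree. -/
def label (x : ℝ × ℝ) : Label n :=
  let j := idx n (x.2 / P.dφ n)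
  (idx n ((x.1 - P.R₀) / P.bCell n), j, decide (P.ang n ((j : ℕ) + 1 / 2) < x.2))

section Membership

variable {P n}

theorem n_pos (n : ℕ+) : (0 : ℝ) < (n : ℕ) := by exact_mod_cast n.pos

theorem bCell_pos : 0 < P.bCell n := div_pos P.b_pos (n_pos n)

theorem dφ_pos : 0 < P.dφ n :=
  div_pos (div_pos P.ε_pos (pow_pos (n_pos n) 2)) bCell_pos

theorem idx_bounds {t : ℝ} (h0 : 0 ≤ t) (h1 : t ≤ (n : ℕ)) :
    ((idx n t : ℕ) : ℝ) ≤ t ∧ t ≤ (idx n t : ℕ) + 1 := by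
  have hn : 1 ≤ (n : ℕ) := n.pos
  have e : ((idx n t : Fin n) : ℕ) = min ⌊t⌋₊ ((n : ℕ) - 1) := rfl
  rw [e]
  rcases le_total ⌊t⌋₊ ((n : ℕ) - 1) with h | h
  · rw [min_eq_left h]
    exact ⟨Nat.floor_le h0, (Nat.lt_floor_add_one t).le⟩
  · rw [min_eq_right h]
    refine ⟨(Nat.cast_le.2 h).trans (Nat.floor_le h0), ?_⟩
    rw [Nat.cast_sub hn]
    simpa using h1

/-- The broken line `E p₋ p₊ F` is the image of the middle angle of the cell. -/
theorem factor_eq (i : ℕ) (r : ℝ) :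
    P.dφ n / 2 * P.factor n i r =
      height (P.aCell n i) (P.bCell n) P.θ (P.εCell n) (r - P.rad n i) := by
  have hs : 0 < Real.sin P.θ :=
    Real.sin_pos_of_pos_of_lt_pi P.θ_pos (by linarith [P.θ_lt, Real.pi_pos])
  have hc : 0 < Real.cos P.θ :=
    Real.cos_pos_of_mem_Ioo ⟨by linarith [P.θ_pos, Real.pi_pos], P.θ_lt⟩
  have ht : Real.tan P.θ = Real.sin P.θ / Real.cos P.θ := Real.tan_eq_sin_div_cos _
  have hb := bCell_pos (P := P) (n := n)
  have hn := n_pos n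
  have hε := P.ε_pos
  have hbb := P.b_pos
  have e1 : P.rad n (i + 1 / 2 - P.D n / 2) =
      P.rad n i + xMinus (P.bCell n) P.θ (P.εCell n) := by
    simp only [rad, D, dφ, xMinus, ht]
    field_simp
    ring
  have e2 : P.rad n (i + 1 / 2 + P.D n / 2) =
      P.rad n i + xPlus (P.bCell n) P.θ (P.εCell n) := by
    simp only [rad, D, dφ, xPlus, ht]
    field_simp
    ring
  have e3 : P.dφ n / 2 * P.rad n i = P.aCell n i / 2 := by
    simp only [rad, dφ, aCell, R₀, bCell, εCell]
    field_simp
  have e4 : P.dφ n / 2 * P.rad n (i + 1) = (P.aCell n i + P.εCell n) / 2 := by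
    simp only [rad, dφ, aCell, R₀, bCell, εCell]
    field_simp
    ring
  have e5 : P.dφ n / 2 * (1 / P.D n) = Real.tan P.θ := by
    have := dφ_pos (P := P) (n := n)
    simp only [D, ht]
    field_simp
  unfold factor height
  rw [e1, e2]
  by_cases h1 : r ≤ P.rad n i + xMinus (P.bCell n) P.θ (P.εCell n)
  · rw [if_pos h1, if_pos (by linarith), e3]
  · have h1' : ¬ r - P.rad n i ≤ xMinus (P.bCell n) P.θ (P.εCell n) :=
      fun h => h1 (by linarith)
    rw [if_neg h1, if_neg h1']
    by_cases h2 : r ≤ P.rad n i + xPlus (P.bCell n) P.θ (P.εCell n)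
    · rw [if_pos h2, if_pos (by linarith), mul_add, e3, ← mul_assoc, e5]
      ring
    · have h2' : ¬ r - P.rad n i ≤ xPlus (P.bCell n) P.θ (P.εCell n) :=
        fun h => h2 (by linarith)
      rw [if_neg h2, if_neg h2', e4]

theorem factor_nonneg (i : ℕ) (r : ℝ) : 0 ≤ P.factor n i r := by
  have hb := bCell_pos (P := P) (n := n)
  have hR : 0 < P.R₀ := div_pos (mul_pos P.a_pos P.b_pos) P.ε_pos
  have hD : 0 < P.D n :=
    div_pos dφ_pos (mul_pos two_pos (Real.tan_pos_of_pos_of_lt_pi_div_two P.θ_pos P.θ_lt))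
  have hr : 0 ≤ P.rad n i := by unfold rad; positivity
  unfold factor
  split_ifs with h1 h2
  · exact hr
  · push Not at h1
    have : 0 ≤ 1 / P.D n * (r - P.rad n (i + 1 / 2 - P.D n / 2)) :=
      mul_nonneg (by positivity) (by linarith)
    linarith
  · unfold rad; positivity

end Membership

/-- `F_n` maps a half-cell into the hexagon with the same label. -/
theorem chartF_mem {x : ℝ × ℝ} (hx : x ∈ P.sector) :
    P.chartF n (P.label n x) x ∈ P.hex n (P.label n x) := by
  obtain ⟨⟨h1, h2⟩, h3, h4⟩ := hx
  have hb := bCell_pos (P := P) (n := n)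
  have hd := dφ_pos (P := P) (n := n)
  have hn := n_pos n
  have hbb := P.b_pos
  have hi := idx_bounds (n := n) (t := (x.1 - P.R₀) / P.bCell n)
    (div_nonneg (by linarith) hb.le) (by
      rw [div_le_iff₀ hb]
      have : ((n : ℕ) : ℝ) * P.bCell n = P.b := by simp only [bCell]; field_simp
      rw [this]; unfold R₁ at h2; linarith)
  have hj := idx_bounds (n := n) (t := x.2 / P.dφ n) (div_nonneg h3 hd.le) (by
      rw [div_le_iff₀ hd]
      have : ((n : ℕ) : ℝ) * P.dφ n = P.ε / P.b := by
        simp only [dφ, bCell, εCell]; field_simp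
      rw [this]; exact h4)
  rw [le_div_iff₀ hb, div_le_iff₀ hb] at hi
  rw [le_div_iff₀ hd, div_le_iff₀ hd] at hj
  have hf := factor_nonneg (P := P) (n := n) (idx n ((x.1 - P.R₀) / P.bCell n)) x.1
  have hH := factor_eq (P := P) (n := n) (idx n ((x.1 - P.R₀) / P.bCell n)) x.1
  have e1 : (P.label n x).1 = idx n ((x.1 - P.R₀) / P.bCell n) := rfl
  have e2 : (P.label n x).2.1 = idx n (x.2 / P.dφ n) := rfl
  have e3 : (P.label n x).2.2 =
      decide (P.ang n ((idx n (x.2 / P.dφ n) : ℕ) + 1 / 2) < x.2) := rfl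
  simp only [hex, hexagon, chartF, Set.mem_ofPred_eq, e1, e2, e3]
  rw [← hH]
  generalize idx n ((x.1 - P.R₀) / P.bCell n) = i at *
  generalize idx n (x.2 / P.dφ n) = j at *
  refine ⟨by unfold rad; linarith, by unfold rad; linarith, ?_⟩
  by_cases h : P.ang n ((j : ℕ) + 1 / 2) < x.2
  · simp only [h, decide_true, if_true]
    unfold ang at h ⊢
    constructor
    · nlinarith
    · nlinarith
  · simp only [h, decide_false, Bool.false_eq_true, if_false]
    unfold ang at h ⊢
    push Not at h
    constructor
    · exact mul_nonneg (by linarith) hf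
    · exact mul_le_mul_of_nonneg_right (by linarith) hf

/-- The map `F_n` from the sector to the surface. -/
def F (x : P.sector) : P.Surface n :=
  Quot.mk _ ⟨P.label n x, ⟨P.chartF n (P.label n x) x, P.chartF_mem n x.2⟩⟩

/-- The distortion of `F_n`. -/
def distortion : ENNReal :=
  ⨆ (x : P.sector) (y : P.sector),
    ENNReal.ofReal |P.sectorDist x y - P.surfaceDist n (P.F n x) (P.F n y)|

/-- The differential of `F_n` at `x`, in the coordinates `(r, φ)` and `(X, Y)`.  It is meaningful
off a null set, namely inside the half-cells and off the arcs `r = r_{i + 1/2 ± D/2}`. -/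
def dF (x : ℝ × ℝ) : ℝ × ℝ →L[ℝ] ℝ × ℝ := fderiv ℝ (P.chartF n (P.label n x)) x

end Params

/-- The linear maps, from the tangent plane at `x` with `dr² + r² dφ²` to the plane with
`dX² + dY²`, that preserve the metric and the orientation. -/
def SO (x : ℝ × ℝ) : Set (ℝ × ℝ →L[ℝ] ℝ × ℝ) :=
  {Q | (∀ v, flatNorm (Q v) = polarNorm x v) ∧ 0 < Q.det}

/-- The operator norm of a linear map from the tangent plane at `x` with `dr² + r² dφ²` to the
plane with `dX² + dY²`. -/
def opNorm (x : ℝ × ℝ) (A : ℝ × ℝ →L[ℝ] ℝ × ℝ) : ℝ :=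
  sSup {c | ∃ v, v ≠ 0 ∧ c = flatNorm (A v) / polarNorm x v}

/-- The distance of `A` from the set of metric- and orientation-preserving maps. -/
def distSO (x : ℝ × ℝ) (A : ℝ × ℝ →L[ℝ] ℝ × ℝ) : ℝ :=
  sInf {c | ∃ Q ∈ SO x, c = opNorm x (A - Q)}

end EdgeDislocation

end

/-!
The map `F` is nearly an isometry off the strips over the middle zones of the columns, of relative
width `D → 0`; on the strips the factor of the angle runs from `r_i` to `r_{i+1}`, a shear of
size up to `tan θ`.

*Upper bound for the distance.* The shear is tamed by a radial map which squeezes a zone of relative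
width `√D` of every column to the middle zone: the Lipschitz constant of its composition with `F`
tends to `1`, while it moves every point by no more than the width of a column.  The images of two
points of the same cell are at a distance bounded by the diameter of the hexagons, so the error
made by the squeeze tends to `0`.

*Lower bound.* The surface is mapped back to the sector by dividing `Y` by a function of `X` that
also runs from `r_i` to `r_{i+1}`, but with a bounded slope.  This map `G` is a Lipschitz map with a
constant that tends to `1`, and `G ∘ F` is close to the identity.

*Differential.* At the radius `r` the matrix `diag (1, r)` belongs to `SO`.  Its distance from `dF`
is at most of the order of the width of a column off the strips, and bounded on the strips, whose
total area tends to `0`.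
-/

noncomputable section

namespace EdgeDislocation

/-! ### Norms -/

theorem polarNorm_nonneg (x v : ℝ × ℝ) : 0 ≤ polarNorm x v := Real.sqrt_nonneg _

theorem flatNorm_nonneg (v : ℝ × ℝ) : 0 ≤ flatNorm v := Real.sqrt_nonneg _

theorem flatNorm_eq_polarNorm (v : ℝ × ℝ) : flatNorm v = polarNorm (1, 0) v := by
  simp [flatNorm, polarNorm]

theorem polarNorm_mono {x y : ℝ × ℝ} (v : ℝ × ℝ) (hx : 0 ≤ x.1) (h : x.1 ≤ y.1) :
    polarNorm x v ≤ polarNorm y v := by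
  unfold polarNorm
  gcongr

theorem polarNorm_le_add (x v : ℝ × ℝ) : polarNorm x v ≤ |v.1| + |x.1| * |v.2| := by
  unfold polarNorm
  rw [Real.sqrt_le_left (by positivity), add_sq, sq_abs, mul_pow, sq_abs, sq_abs]
  nlinarith [mul_nonneg (abs_nonneg v.1) (mul_nonneg (abs_nonneg x.1) (abs_nonneg v.2))]

theorem flatNorm_le_add (v : ℝ × ℝ) : flatNorm v ≤ |v.1| + |v.2| := by
  simpa [flatNorm_eq_polarNorm] using polarNorm_le_add (1, 0) v

theorem polarNorm_le_of_nearly_diagonal {x y u v : ℝ × ℝ} {q t : ℝ} (hq : 0 ≤ q) (ht : 0 ≤ t)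
    (h₁ : |u.1| ≤ q * |v.1|) (h₂ : |x.1 * u.2| ≤ q * |y.1 * v.2| + t * |v.1|) :
    polarNorm x u ≤ (q + t) * polarNorm y v := by
  unfold polarNorm
  rw [Real.sqrt_le_left (by positivity), mul_pow, Real.sq_sqrt (by positivity), ← mul_pow,
    ← mul_pow, ← sq_abs u.1, ← sq_abs (x.1 * u.2), ← sq_abs v.1, ← sq_abs (y.1 * v.2)]
  have hqt := mul_nonneg hq ht
  calc |u.1| ^ 2 + |x.1 * u.2| ^ 2
      ≤ (q * |v.1|) ^ 2 + (q * |y.1 * v.2| + t * |v.1|) ^ 2 := by gcongr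
    _ ≤ (q + t) ^ 2 * (|v.1| ^ 2 + |y.1 * v.2| ^ 2) := by
      nlinarith [mul_nonneg hqt (sq_nonneg (|v.1| - |y.1 * v.2|)),
        mul_nonneg hqt (sq_nonneg |v.1|), mul_nonneg hqt (sq_nonneg |y.1 * v.2|),
        sq_nonneg (t * |y.1 * v.2|)]

theorem flatNorm_sub_comm (v w : ℝ × ℝ) : flatNorm (v - w) = flatNorm (w - v) := by
  simp only [flatNorm, Prod.fst_sub, Prod.snd_sub, sub_sq_comm]

/-- A continuous, absolutely homogeneous field of lengths of tangent vectors, such as the norm of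
a Riemannian metric. -/
structure IsLengthElement (nrm : ℝ × ℝ → ℝ × ℝ → ℝ) : Prop where
  continuous : Continuous fun p : (ℝ × ℝ) × ℝ × ℝ => nrm p.1 p.2
  smul (x : ℝ × ℝ) (c : ℝ) (v : ℝ × ℝ) : nrm x (c • v) = |c| * nrm x v
  nonneg (x v : ℝ × ℝ) : 0 ≤ nrm x v

theorem polarNorm_smul (x : ℝ × ℝ) (c : ℝ) (v : ℝ × ℝ) :
    polarNorm x (c • v) = |c| * polarNorm x v := by
  rw [polarNorm, polarNorm, ← Real.sqrt_sq (abs_nonneg c), ← Real.sqrt_mul (sq_nonneg _), sq_abs]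
  simp only [Prod.smul_fst, Prod.smul_snd, smul_eq_mul]
  ring_nf

theorem isLengthElement_polarNorm : IsLengthElement polarNorm where
  continuous := by unfold polarNorm; fun_prop
  smul := polarNorm_smul
  nonneg := polarNorm_nonneg

theorem isLengthElement_flatNorm : IsLengthElement fun _ v => flatNorm v where
  continuous := by unfold flatNorm; fun_prop
  smul _ c v := by simp only [flatNorm_eq_polarNorm, polarNorm_smul]
  nonneg _ := flatNorm_nonneg

/-! ### Arcs -/

section Arc

variable {S : Set (ℝ × ℝ)} {nrm : ℝ × ℝ → ℝ × ℝ → ℝ} {x y : ℝ × ℝ} {K L : ℝ}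

theorem IsLengthElement.apply_zero (hn : IsLengthElement nrm) (x : ℝ × ℝ) : nrm x 0 = 0 := by
  simpa using hn.smul x 0 0

theorem IsArc.nonneg (hn : ∀ x v, 0 ≤ nrm x v) (h : IsArc S nrm x y L) : 0 ≤ L := by
  obtain ⟨γ, s, t, hst, -, -, -, -, rfl⟩ := h
  exact intervalIntegral.integral_nonneg hst fun _ _ => hn _ _

theorem isArc_segment (nrm : ℝ × ℝ → ℝ × ℝ → ℝ) (hS : Convex ℝ S) (hx : x ∈ S) (hy : y ∈ S) :
    IsArc S nrm x y (∫ τ in (0 : ℝ)..1, nrm (x + τ • (y - x)) (y - x)) := by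
  refine ⟨fun τ => x + τ • (y - x), 0, 1, zero_le_one, by fun_prop,
    fun τ hτ => hS.add_smul_sub_mem hx hy hτ, by simp, by simp, ?_⟩
  have hderiv (τ : ℝ) : HasDerivAt (fun τ : ℝ => x + τ • (y - x)) (y - x) τ := by
    simpa using ((hasDerivAt_id τ).smul_const (y - x)).const_add x
  simp only [(hderiv _).deriv]

theorem isArc_flat_segment (hS : Convex ℝ S) (hx : x ∈ S) (hy : y ∈ S) :
    IsArc S (fun _ v => flatNorm v) x y (flatNorm (y - x)) := by
  simpa using isArc_segment (fun _ v => flatNorm v) hS hx hy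

theorem IsArc.mono {S' : Set (ℝ × ℝ)} (hS : S ⊆ S') (h : IsArc S nrm x y L) :
    IsArc S' nrm x y L := by
  obtain ⟨γ, s, t, hst, hγ, hmem, h⟩ := h
  exact ⟨γ, s, t, hst, hγ, fun τ hτ => hS (hmem τ hτ), h⟩

theorem IsLengthElement.continuous_comp_deriv (hn : IsLengthElement nrm) {γ : ℝ → ℝ × ℝ}
    (hγ : ContDiff ℝ 1 γ) : Continuous fun τ => nrm (γ τ) (deriv γ τ) :=
  hn.continuous.comp (hγ.continuous.prodMk (hγ.continuous_deriv le_rfl))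

variable {δ : S → S → ℝ}

theorem IsLengthElement.continuous_of_eventually (hn : IsLengthElement nrm)
    (htri : ∀ x y z, δ x z ≤ δ x y + δ y z)
    (hloc : ∀ x : S, ∀ᶠ y in 𝓝 x, δ x y ≤ K * nrm x (y - x) ∧ δ y x ≤ K * nrm x (y - x)) (x : S) :
    Continuous (δ x) := by
  refine continuous_iff_continuousAt.2 fun y => tendsto_iff_dist_tendsto_zero.2 ?_
  have hlim : Tendsto (fun z : S => K * nrm y (z - y)) (𝓝 y) (𝓝 0) := by
    have hcont : Continuous fun z : S => K * nrm y (z - y) :=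
      continuous_const.mul (hn.continuous.comp (by fun_prop : Continuous fun z : S =>
        ((y : ℝ × ℝ), (z - y : ℝ × ℝ))))
    simpa [hn.apply_zero] using hcont.tendsto y
  refine squeeze_zero' (.of_forall fun _ => dist_nonneg) ?_ hlim
  filter_upwards [hloc y] with z hz
  rw [Real.dist_eq, abs_le]
  constructor <;> linarith [htri x y z, htri x z y, hz.1, hz.2]

/-- The left side grows along the arc at a rate of at most `K` times the speed. -/
theorem IsArc.le_mul_of_eventually (hn : IsLengthElement nrm) (hself : ∀ x, δ x x ≤ 0)
    (htri : ∀ x y z, δ x z ≤ δ x y + δ y z)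
    (hloc : ∀ x : S, ∀ᶠ y in 𝓝 x, δ x y ≤ K * nrm x (y - x) ∧ δ y x ≤ K * nrm x (y - x))
    {x y : S} (h : IsArc S nrm x y L) : δ x y ≤ K * L := by
  obtain ⟨γ, s, t, hst, hγ, hmem, hγs, hγt, rfl⟩ := h
  let c : ℝ → S := fun τ => ⟨γ (projIcc s t hst τ), hmem _ (projIcc s t hst τ).2⟩
  have hc : ∀ τ ∈ Icc s t, (c τ : ℝ × ℝ) = γ τ := fun τ hτ => by simp [c, projIcc_of_mem hst hτ]
  have hc_cont : Continuous c := by have := hγ.continuous; fun_prop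
  have hcs : c s = x := Subtype.ext ((hc s (left_mem_Icc.2 hst)).trans hγs)
  have hct : c t = y := Subtype.ext ((hc t (right_mem_Icc.2 hst)).trans hγt)
  have hspeed := hn.continuous_comp_deriv hγ
  have hB (τ : ℝ) : HasDerivAt (fun τ => K * ∫ u in s..τ, nrm (γ u) (deriv γ u))
      (K * nrm (γ τ) (deriv γ τ)) τ :=
    (hspeed.integral_hasStrictDerivAt s τ).hasDerivAt.const_mul K
  rw [← hct]
  refine image_le_of_liminf_slope_right_le_deriv_boundary (f := fun τ => δ x (c τ))
    ((hn.continuous_of_eventually htri hloc x).comp hc_cont).continuousOn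
    (by simpa [hcs] using hself x) (HasDerivAt.continuousOn fun τ _ => hB τ)
    (fun τ _ => (hB τ).hasDerivWithinAt) (fun τ hτ r hr => ?_) (right_mem_Icc.2 hst)
  have hcτ : (c τ : ℝ × ℝ) = γ τ := hc τ (Ico_subset_Icc_self hτ)
  have hslope : Tendsto (fun z => K * nrm (γ τ) (slope γ τ z)) (𝓝[>] τ)
      (𝓝 (K * nrm (γ τ) (deriv γ τ))) := by
    have hγ' := (hγ.differentiable one_ne_zero τ).hasDerivAt
    exact ((hn.continuous.tendsto (γ τ, deriv γ τ)).comp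
      (tendsto_const_nhds.prodMk_nhds (hasDerivAt_iff_tendsto_slope.1 hγ' |>.mono_left
        (nhdsWithin_mono _ fun z hz => ne_of_gt hz)))).const_mul K
  refine Eventually.frequently ?_
  filter_upwards [hslope.eventually_lt_const hr, Ioc_mem_nhdsGT hτ.2,
    (hc_cont.tendsto τ).mono_left nhdsWithin_le_nhds |>.eventually (hloc (c τ))]
    with z hzr hz hzloc
  refine lt_of_le_of_lt ?_ hzr
  have hcz : (c z : ℝ × ℝ) = γ z := hc z ⟨hτ.1.trans hz.1.le, hz.2⟩
  rw [slope_def_field, slope_def_module, hn.smul, abs_of_pos (inv_pos.2 (sub_pos.2 hz.1)),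
    mul_left_comm, div_eq_inv_mul]
  have hzloc := hzloc.1
  rw [hcτ, hcz] at hzloc
  have := htri x (c τ) (c z)
  have := inv_pos.2 (sub_pos.2 hz.1)
  gcongr
  linarith

end Arc

/-! ### Chains -/

section Chain

variable {α : Type} {arc : α → α → ℝ → Prop} {p q r : α} {K L L' : ℝ}

theorem Chain.trans (h : Chain arc p q L) (h' : Chain arc q r L') : Chain arc p r (L + L') := by
  induction h with
  | nil => simpa using h'
  | cons a _ ih => rw [add_assoc]; exact .cons a (ih h')

theorem Chain.single (h : arc p q L) : Chain arc p q L := by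
  simpa using Chain.cons h (.nil q)

theorem Chain.nonneg (hnn : ∀ p q L, arc p q L → 0 ≤ L) (h : Chain arc p q L) : 0 ≤ L := by
  induction h with
  | nil => exact le_rfl
  | cons a _ ih => exact add_nonneg (hnn _ _ _ a) ih

/-- The two points are joined by some chain.  Otherwise `pathDist` is the infimum of the empty
set, which is `0`. -/
def Reachable (arc : α → α → ℝ → Prop) (p q : α) : Prop := ∃ L, Chain arc p q L

theorem Reachable.trans (h : Reachable arc p q) (h' : Reachable arc q r) : Reachable arc p r :=
  ⟨_, h.choose_spec.trans h'.choose_spec⟩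

theorem pathDist_le (hnn : ∀ p q L, arc p q L → 0 ≤ L) (h : Chain arc p q L) :
    pathDist arc p q ≤ L :=
  csInf_le ⟨0, fun _ hL => hL.nonneg hnn⟩ h

theorem pathDist_triangle (hnn : ∀ p q L, arc p q L → 0 ≤ L) (h : Reachable arc p q)
    (h' : Reachable arc q r) : pathDist arc p r ≤ pathDist arc p q + pathDist arc q r := by
  rw [← sub_le_iff_le_add]
  refine le_csInf h fun l hl => ?_
  rw [sub_le_comm]
  refine le_csInf h' fun l' hl' => ?_
  rw [sub_le_iff_le_add']
  exact pathDist_le hnn (hl.trans hl')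

theorem le_mul_pathDist {δ : α → α → ℝ} (hK : 0 < K) (hself : ∀ p, δ p p ≤ 0)
    (htri : ∀ p q r, δ p r ≤ δ p q + δ q r) (harc : ∀ p q L, arc p q L → δ p q ≤ K * L)
    (h : Reachable arc p q) : δ p q ≤ K * pathDist arc p q := by
  rw [← div_le_iff₀' hK]
  refine le_csInf h fun L hL => ?_
  rw [div_le_iff₀' hK]
  induction hL with
  | nil p => simpa using hself p
  | cons a t ih => rw [mul_add]; exact (htri _ _ _).trans (add_le_add (harc _ _ _ a) (ih ⟨_, t⟩))

end Chain

/-! ### Ramps -/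

section Ramp

variable {w s s' : ℝ}

/-- The broken line that rises from `0` to `1` over the interval of length `w` centred at
`1 / 2`. -/
def ramp (w s : ℝ) : ℝ := projIcc (0 : ℝ) 1 zero_le_one (1 / 2 + (s - 1 / 2) / w)

theorem ramp_mem_Icc (w s : ℝ) : ramp w s ∈ Icc (0 : ℝ) 1 := Subtype.prop _

theorem ramp_monotone (hw : 0 < w) : Monotone (ramp w) := fun s s' h =>
  monotone_projIcc zero_le_one (show 1 / 2 + (s - 1 / 2) / w ≤ 1 / 2 + (s' - 1 / 2) / w by gcongr)

theorem ramp_of_le (hw : 0 < w) (h : s ≤ (1 - w) / 2) : ramp w s = 0 := by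
  rw [ramp, projIcc_of_le_left]
  have : (s - 1 / 2) / w ≤ -(1 / 2) := by rw [div_le_iff₀ hw]; linarith
  linarith

theorem ramp_of_ge (hw : 0 < w) (h : (1 + w) / 2 ≤ s) : ramp w s = 1 := by
  rw [ramp, projIcc_of_right_le]
  have : 1 / 2 ≤ (s - 1 / 2) / w := by rw [le_div_iff₀ hw]; linarith
  linarith

theorem ramp_eq_min (hw : 0 < w) (h : (1 - w) / 2 ≤ s) :
    ramp w s = min 1 (1 / 2 + (s - 1 / 2) / w) := by
  have : -(1 / 2) ≤ (s - 1 / 2) / w := by rw [le_div_iff₀ hw]; linarith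
  rw [ramp, coe_projIcc, max_eq_right (le_min zero_le_one (by linarith))]

theorem ramp_of_mem (hw : 0 < w) (h : s ∈ Icc ((1 - w) / 2) ((1 + w) / 2)) :
    ramp w s = 1 / 2 + (s - 1 / 2) / w := by
  have : (s - 1 / 2) / w ≤ 1 / 2 := by rw [div_le_iff₀ hw]; linarith [h.2]
  rw [ramp_eq_min hw h.1, min_eq_right (by linarith)]

theorem abs_ramp_sub_le (hw : 0 < w) (s s' : ℝ) : |ramp w s - ramp w s'| ≤ |s - s'| / w := by
  refine (abs_projIcc_sub_projIcc zero_le_one).trans_eq ?_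
  rw [add_sub_add_left_eq_sub, ← sub_div, sub_sub_sub_cancel_right, abs_div, abs_of_pos hw]

theorem le_ramp (hw : 0 < w) (hw' : w ≤ 1 / 2) (hs : s ≤ 1) : 2 * s - 1 ≤ ramp w s := by
  rcases le_total s ((1 - w) / 2) with h | h
  · rw [ramp_of_le hw h]; linarith
  rw [ramp_eq_min hw h]
  refine le_min (by linarith) ?_
  rcases le_total (1 / 2) s with h' | h'
  · have : 2 * (s - 1 / 2) ≤ (s - 1 / 2) / w := by rw [le_div_iff₀ hw]; nlinarith
    linarith
  · have : -(1 / 2) ≤ (s - 1 / 2) / w := by rw [le_div_iff₀ hw]; linarith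
    linarith

/-- The half-line to the left or to the right of the lower kink of `ramp w`. -/
def kinkSide (w : ℝ) (right : Bool) : Set ℝ :=
  if right then Ici ((1 - w) / 2) else Iic ((1 - w) / 2)

theorem kink_mem_kinkSide (w : ℝ) (right : Bool) : (1 - w) / 2 ∈ kinkSide w right := by
  cases right <;> simp [kinkSide]

theorem isClosed_kinkSide (w : ℝ) (right : Bool) : IsClosed (kinkSide w right) := by
  cases right
  exacts [isClosed_Iic, isClosed_Ici]

theorem exists_mem_kinkSide (w s : ℝ) : ∃ right, s ∈ kinkSide w right :=
  (le_total s ((1 - w) / 2)).elim (fun h => ⟨false, h⟩) fun h => ⟨true, h⟩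

theorem concaveOn_ramp (hw : 0 < w) (right : Bool) : ConcaveOn ℝ (kinkSide w right) (ramp w) := by
  cases right
  · exact (concaveOn_const 0 (convex_Iic _)).congr fun _ hs => (ramp_of_le hw hs).symm
  refine ConcaveOn.congr (f := fun s => min 1 (1 / 2 + (s - 1 / 2) / w)) ?_
    fun s hs => (ramp_eq_min hw hs).symm
  refine (concaveOn_const 1 (convex_Ici _)).inf ⟨convex_Ici _, fun s _ t _ c d _ _ h => ?_⟩
  obtain rfl : c = 1 - d := by linarith
  simp only [smul_eq_mul]
  exact le_of_eq (by ring)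

end Ramp

/-! ### Compression of the middle zones -/

section Compress

variable {e s s' : ℝ}

/-- The `1`-periodic change of parameter that shrinks the middle part of length `e` of every
interval `[i, i + 1]` to length `e ^ 2` and stretches the remainder by `1 + e`. -/
def compress (e t : ℝ) : ℝ := t + e * (Int.fract t - ramp e (Int.fract t))

theorem compress_natCast_add (e : ℝ) (i : ℕ) (s : ℝ) :
    compress e (i + s) = i + compress e s := by
  simp only [compress, Int.fract_natCast_add, add_assoc]

theorem compress_eq (he : 0 < e) (he' : e ≤ 1) (hs : s ∈ Icc (0 : ℝ) 1) :
    compress e s = s + e * (s - ramp e s) := by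
  rcases hs.2.eq_or_lt with rfl | h
  · rw [compress, Int.fract_one, ramp_of_le he (by linarith), ramp_of_ge he (by linarith)]
    ring
  · rw [compress, Int.fract_eq_self.2 ⟨hs.1, h⟩]

theorem compress_of_le (he : 0 < e) (he' : e ≤ 1) (hs : s ∈ Icc (0 : ℝ) ((1 - e) / 2)) :
    compress e s = (1 + e) * s := by
  rw [compress_eq he he' ⟨hs.1, by linarith [hs.2]⟩, ramp_of_le he hs.2]
  ring

theorem compress_of_mem (he : 0 < e) (he' : e ≤ 1) (hs : s ∈ Icc ((1 - e) / 2) ((1 + e) / 2)) :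
    compress e s = 1 / 2 + e * (s - 1 / 2) := by
  rw [compress_eq he he' ⟨by linarith [hs.1], by linarith [hs.2]⟩, ramp_of_mem he hs]
  field_simp
  ring

theorem compress_of_ge (he : 0 < e) (he' : e ≤ 1) (hs : s ∈ Icc ((1 + e) / 2) 1) :
    compress e s = 1 - (1 + e) * (1 - s) := by
  rw [compress_eq he he' ⟨by linarith [hs.1], hs.2⟩, ramp_of_ge he hs.1]
  ring

theorem ramp_compress (he : 0 < e) (he' : e ≤ 1) (hs : s ∈ Icc (0 : ℝ) 1) :
    ramp (e ^ 2) (compress e s) = ramp e s := by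
  have hee := pow_pos he 2
  rcases le_total s ((1 - e) / 2) with h | h
  · rw [compress_of_le he he' ⟨hs.1, h⟩, ramp_of_le he h, ramp_of_le hee (by nlinarith)]
  rcases le_total s ((1 + e) / 2) with h' | h'
  · rw [compress_of_mem he he' ⟨h, h'⟩, ramp_of_mem he ⟨h, h'⟩,
      ramp_of_mem hee ⟨by nlinarith, by nlinarith⟩]
    field_simp
    ring
  · rw [compress_of_ge he he' ⟨h', hs.2⟩, ramp_of_ge he h', ramp_of_ge hee (by nlinarith)]

theorem compress_sub_mem_Icc (he : 0 < e) (he' : e ≤ 1) (hs : s ∈ Icc (0 : ℝ) 1)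
    (hs' : s' ∈ Icc (0 : ℝ) 1) (h : s' ≤ s) :
    compress e s - compress e s' ∈ Icc 0 ((1 + e) * (s - s')) := by
  have hmono := ramp_monotone he h
  have hlip := (le_abs_self _).trans (abs_ramp_sub_le he s s')
  rw [abs_of_nonneg (sub_nonneg.2 h), le_div_iff₀ he] at hlip
  rw [compress_eq he he' hs, compress_eq he he' hs']
  constructor <;> nlinarith

theorem compress_monotoneOn (he : 0 < e) (he' : e ≤ 1) :
    MonotoneOn (compress e) (Icc 0 1) := fun _ hs' _ hs h =>
  sub_nonneg.1 (compress_sub_mem_Icc he he' hs hs' h).1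

theorem abs_compress_sub_le (he : 0 < e) (he' : e ≤ 1) (hs : s ∈ Icc (0 : ℝ) 1)
    (hs' : s' ∈ Icc (0 : ℝ) 1) : |compress e s - compress e s'| ≤ (1 + e) * |s - s'| := by
  wlog h : s' ≤ s generalizing s s'
  · rw [abs_sub_comm, abs_sub_comm s]
    exact this hs' hs (le_of_not_ge h)
  have hmem := compress_sub_mem_Icc he he' hs hs' h
  rw [abs_of_nonneg hmem.1, abs_of_nonneg (sub_nonneg.2 h)]
  exact hmem.2

theorem compress_mem_Icc (he : 0 < e) (he' : e ≤ 1) (hs : s ∈ Icc (0 : ℝ) 1) :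
    compress e s ∈ Icc (0 : ℝ) 1 := by
  have h₀ := compress_monotoneOn he he' (left_mem_Icc.2 zero_le_one) hs hs.1
  have h₁ := compress_monotoneOn he he' hs (right_mem_Icc.2 zero_le_one) hs.2
  rw [compress_of_le he he' ⟨le_rfl, by linarith⟩, mul_zero] at h₀
  rw [compress_of_ge he he' ⟨by linarith, le_rfl⟩, sub_self, mul_zero, sub_zero] at h₁
  exact ⟨h₀, h₁⟩

theorem compress_mem_kinkSide (he : 0 < e) (he' : e ≤ 1) (hs : s ∈ Icc (0 : ℝ) 1) {right : Bool}
    (h : s ∈ kinkSide e right) : compress e s ∈ kinkSide (e ^ 2) right := by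
  have hkink : (1 - e) / 2 ∈ Icc (0 : ℝ) 1 := ⟨by linarith, by linarith⟩
  have hcompress : compress e ((1 - e) / 2) = (1 - e ^ 2) / 2 := by
    rw [compress_of_le he he' ⟨hkink.1, le_rfl⟩]
    ring
  cases right
  · exact (compress_monotoneOn he he' hs hkink h).trans_eq hcompress
  · exact hcompress.symm.trans_le (compress_monotoneOn he he' hkink hs h)

end Compress

namespace Params

variable {P : Params} {n : ℕ+}

/-! ### The sector -/

theorem R₀_pos (P : Params) : 0 < P.R₀ := div_pos (mul_pos P.a_pos P.b_pos) P.ε_pos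

theorem R₁_pos (P : Params) : 0 < P.R₁ := add_pos (R₀_pos P) P.b_pos

theorem convex_sector : Convex ℝ P.sector := (convex_Icc _ _).prod (convex_Icc _ _)

theorem fst_pos_of_mem_sector {x : ℝ × ℝ} (hx : x ∈ P.sector) : 0 < x.1 :=
  (R₀_pos P).trans_le hx.1.1

theorem sectorArc_nonneg (p q : P.sector) (L : ℝ) (h : IsArc P.sector polarNorm p q L) : 0 ≤ L :=
  h.nonneg polarNorm_nonneg

theorem reachable_sector (x y : P.sector) :
    Reachable (fun p q : P.sector => IsArc P.sector polarNorm p q) x y :=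
  ⟨_, .single (isArc_segment polarNorm convex_sector x.2 y.2)⟩

theorem sectorDist_triangle (x y z : P.sector) :
    P.sectorDist x z ≤ P.sectorDist x y + P.sectorDist y z :=
  pathDist_triangle sectorArc_nonneg (reachable_sector x y) (reachable_sector y z)

theorem sectorDist_self (x : P.sector) : P.sectorDist x x ≤ 0 :=
  pathDist_le sectorArc_nonneg (.nil x)

theorem sectorDist_le (x y : P.sector) {R : ℝ} (hx : x.1.1 ≤ R) (hy : y.1.1 ≤ R) :
    P.sectorDist x y ≤ polarNorm (R, 0) (y - x) := by
  refine (pathDist_le sectorArc_nonneg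
    (.single (isArc_segment polarNorm convex_sector x.2 y.2))).trans ?_
  have hcont : Continuous fun τ : ℝ => polarNorm (x + τ • (y - x)) (y - x) := by
    unfold polarNorm; fun_prop
  calc ∫ τ in (0 : ℝ)..1, polarNorm (x + τ • (y - x)) (y - x)
      ≤ ∫ _ in (0 : ℝ)..1, polarNorm (R, 0) (y - x) := by
        refine intervalIntegral.integral_mono_on zero_le_one (hcont.intervalIntegrable _ _)
          (by simp) fun τ hτ => polarNorm_mono _
            (fst_pos_of_mem_sector (convex_sector.add_smul_sub_mem x.2 y.2 hτ)).le ?_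
        exact (convex_Iic R).add_smul_sub_mem hx hy hτ
    _ = polarNorm (R, 0) (y - x) := by simp

theorem sectorDist_le_add (x y : P.sector) :
    P.sectorDist x y ≤ |y.1.1 - x.1.1| + P.R₁ * |y.1.2 - x.1.2| := by
  have h := (sectorDist_le x y x.2.1.2 y.2.1.2).trans (polarNorm_le_add _ _)
  rwa [abs_of_nonneg (R₁_pos P).le] at h

theorem sectorDist_le_diam (x y : P.sector) :
    P.sectorDist x y ≤ P.b + P.R₁ * (P.ε / P.b) := by
  have hR := (R₁_pos P).le
  refine (sectorDist_le_add x y).trans ?_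
  gcongr
  · simpa [R₁] using abs_sub_le_of_le_of_le y.2.1.1 y.2.1.2 x.2.1.1 x.2.1.2
  · simpa using abs_sub_le_of_le_of_le y.2.2.1 y.2.2.2 x.2.2.1 x.2.2.2

/-! ### Columns and rows -/

theorem tan_pos (P : Params) : 0 < Real.tan P.θ :=
  Real.tan_pos_of_pos_of_lt_pi_div_two P.θ_pos P.θ_lt

theorem D_pos : 0 < P.D n := div_pos dφ_pos (mul_pos two_pos (tan_pos P))

theorem half_dφ_pos : 0 < P.dφ n / 2 := half_pos dφ_pos

theorem half_dφ_eq : P.dφ n / 2 = Real.tan P.θ * P.D n := by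
  have := tan_pos P
  unfold D
  field_simp

theorem n_mul_bCell : ((n : ℕ) : ℝ) * P.bCell n = P.b := mul_div_cancel₀ _ (n_pos n).ne'

theorem n_mul_dφ : ((n : ℕ) : ℝ) * P.dφ n = P.ε / P.b := by
  have := n_pos n
  have := P.b_pos
  simp only [dφ, bCell, εCell]
  field_simp

/-- The position of the radius `r` in units of the width of a column, the inverse of `rad`. -/
def col (P : Params) (n : ℕ+) (r : ℝ) : ℝ := (r - P.R₀) / P.bCell n

/-- The position of the angle `φ` in units of half the height of a cell. -/
def row (P : Params) (n : ℕ+) (φ : ℝ) : ℝ := φ / (P.dφ n / 2)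

theorem col_rad (s : ℝ) : P.col n (P.rad n s) = s := by
  have := bCell_pos (P := P) (n := n)
  unfold col rad
  field_simp
  ring

theorem rad_col (r : ℝ) : P.rad n (P.col n r) = r := by
  have := bCell_pos (P := P) (n := n)
  unfold col rad
  field_simp
  ring

theorem rad_sub_rad (s t : ℝ) : P.rad n s - P.rad n t = (s - t) * P.bCell n := by
  unfold rad; ring

theorem col_sub_col (r r' : ℝ) : P.col n r - P.col n r' = (r - r') / P.bCell n := by
  unfold col; ring

theorem rad_le_rad_iff {s t : ℝ} : P.rad n s ≤ P.rad n t ↔ s ≤ t := by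
  simp only [rad, add_le_add_iff_left, mul_le_mul_iff_left₀ bCell_pos]

theorem col_le_iff {r t : ℝ} : P.col n r ≤ t ↔ r ≤ P.rad n t := by
  rw [← rad_le_rad_iff (P := P) (n := n), rad_col]

theorem le_col_iff {r t : ℝ} : t ≤ P.col n r ↔ P.rad n t ≤ r := by
  rw [← rad_le_rad_iff (P := P) (n := n), rad_col]

theorem rad_zero : P.rad n 0 = P.R₀ := by simp [rad]

theorem rad_n : P.rad n (n : ℕ) = P.R₁ := by rw [rad, n_mul_bCell, R₁]

theorem R₀_le_rad {s : ℝ} (hs : 0 ≤ s) : P.R₀ ≤ P.rad n s := by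
  rw [← rad_zero (n := n)]
  exact rad_le_rad_iff.2 hs

theorem rad_pos {s : ℝ} (hs : 0 ≤ s) : 0 < P.rad n s := (R₀_pos P).trans_le (R₀_le_rad hs)

theorem cast_add_one_le (i : Fin n) : ((i : ℕ) : ℝ) + 1 ≤ (n : ℕ) := by
  exact_mod_cast i.2

/-- The ratio `1 + b_n / R₀`, a bound for the quotient of two radii in the same column. -/
def ratio (P : Params) (n : ℕ+) : ℝ := 1 + P.bCell n / P.R₀

theorem one_le_ratio : 1 ≤ P.ratio n :=
  le_add_of_nonneg_right (div_pos bCell_pos (R₀_pos P)).le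

theorem rad_add_one_le_ratio_mul {i r : ℝ} (hi : 0 ≤ i) (h : P.rad n i ≤ r) :
    P.rad n (i + 1) ≤ P.ratio n * r := by
  have hb : P.bCell n ≤ P.bCell n / P.R₀ * r := by
    rw [div_mul_eq_mul_div, le_div_iff₀ (R₀_pos P)]
    exact mul_le_mul_of_nonneg_left ((R₀_le_rad hi).trans h) bCell_pos.le
  have := rad_sub_rad (P := P) (n := n) (i + 1) i
  unfold ratio
  linarith

theorem factor_eq_rad (i : ℕ) (r : ℝ) :
    P.factor n i r = P.rad n (i + ramp (P.D n) (P.col n r - i)) := by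
  have hD := D_pos (P := P) (n := n)
  have hb := bCell_pos (P := P) (n := n)
  unfold factor
  simp only [← col_le_iff]
  split_ifs with h₁ h₂
  · rw [ramp_of_le hD (by linarith), add_zero]
  · rw [ramp_of_mem hD ⟨by linarith, by linarith⟩]
    unfold rad col
    field_simp
    ring
  · rw [ramp_of_ge hD (by linarith)]

theorem factor_mem_Icc (i : ℕ) (r : ℝ) :
    P.factor n i r ∈ Icc (P.rad n i) (P.rad n (i + 1)) := by
  have := ramp_mem_Icc (P.D n) (P.col n r - i)
  rw [factor_eq_rad]
  exact ⟨rad_le_rad_iff.2 (by linarith [this.1]), rad_le_rad_iff.2 (by linarith [this.2])⟩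

theorem height_eq (i : ℕ) (X : ℝ) : height (P.aCell n i) (P.bCell n) P.θ (P.εCell n) X =
    P.dφ n / 2 * P.factor n i (P.rad n i + X) := by
  rw [factor_eq, add_sub_cancel_left]

/-! ### Half-cells -/

/-- `1` for lower and `-1` for upper hexagons: the direction, away from the edge on the line
`Y = 0`, in which the hexagon extends. -/
def side (up : Bool) : ℝ := if up then -1 else 1

/-- The number of the half-row of hexagons that contains the hexagon with label `h`. -/
def level (h : Label n) : ℕ := 2 * h.2.1 + h.2.2.toNat

/-- The angle from which angles are measured in `chartF`. -/
def baseAngle (P : Params) (n : ℕ+) (h : Label n) : ℝ :=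
  if h.2.2 then P.ang n ((h.2.1 : ℕ) + 1) else P.ang n (h.2.1 : ℕ)

/-- The closed half-cell of the sector that `F` maps to the hexagon with label `h`. -/
def halfCell (P : Params) (n : ℕ+) (h : Label n) : Set (ℝ × ℝ) :=
  {x | P.col n x.1 ∈ Icc (h.1 : ℝ) (h.1 + 1) ∧ P.row n x.2 ∈ Icc (level h : ℝ) (level h + 1)}

theorem side_mul_side (up : Bool) : side up * side up = 1 := by cases up <;> simp [side]

theorem abs_side_mul (up : Bool) (t : ℝ) : |side up * t| = |t| := by cases up <;> simp [side]

theorem mem_hex {h : Label n} {x : ℝ × ℝ} : x ∈ P.hex n h ↔ x.1 ∈ Icc 0 (P.bCell n) ∧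
    side h.2.2 * x.2 ∈ Icc 0 (P.dφ n / 2 * P.factor n h.1 (P.rad n h.1 + x.1)) := by
  obtain ⟨i, j, up⟩ := h
  cases up <;>
    simp only [hex, hexagon, mem_ofPred_eq, height_eq, mem_Icc, side, Bool.false_eq_true, if_false,
      if_true, neg_mul, one_mul, and_assoc, neg_nonneg, neg_le, and_comm]

theorem side_mul_sub_mem_Icc {h : Label n} {φ : ℝ} :
    side h.2.2 * (φ - P.baseAngle n h) ∈ Icc 0 (P.dφ n / 2) ↔
      P.row n φ ∈ Icc (level h : ℝ) (level h + 1) := by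
  obtain ⟨i, j, up⟩ := h
  have hd := half_dφ_pos (P := P) (n := n)
  simp only [mem_Icc, row, le_div_iff₀ hd, div_le_iff₀ hd]
  cases up <;>
    simp only [side, baseAngle, level, ang, Bool.false_eq_true, if_false, if_true, one_mul,
      neg_mul, Bool.toNat_false, Bool.toNat_true] <;>
    push_cast <;> constructor <;> rintro ⟨h₁, h₂⟩ <;> constructor <;> linarith

theorem label_mem {x : ℝ × ℝ} (hx : x ∈ P.sector) : x ∈ P.halfCell n (P.label n x) := by
  obtain ⟨⟨h₁, h₂⟩, h₃, h₄⟩ := hx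
  have hd := dφ_pos (P := P) (n := n)
  have hi := idx_bounds (n := n) (t := P.col n x.1)
    (le_col_iff.2 (by rwa [rad_zero])) (col_le_iff.2 (by rwa [rad_n]))
  have hj := idx_bounds (n := n) (t := x.2 / P.dφ n) (div_nonneg h₃ hd.le)
    (by rwa [div_le_iff₀ hd, n_mul_dφ])
  refine ⟨hi, ?_⟩
  rw [le_div_iff₀ hd, div_le_iff₀ hd] at hj
  simp only [level, label, row, ang, mem_Icc, le_div_iff₀ half_dφ_pos, div_le_iff₀ half_dφ_pos]
  generalize idx n (x.2 / P.dφ n) = j at *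
  by_cases h : ((j : ℕ) + 1 / 2) * P.dφ n < x.2 <;>
    simp only [h, decide_true, decide_false, Bool.toNat_true, Bool.toNat_false] <;> push_cast <;>
    constructor <;> linarith

theorem halfCell_subset_sector (h : Label n) : P.halfCell n h ⊆ P.sector := by
  rintro x ⟨⟨h₁, h₂⟩, h₃, h₄⟩
  rw [le_col_iff] at h₁
  rw [col_le_iff] at h₂
  rw [row, le_div_iff₀ half_dφ_pos] at h₃
  rw [row, div_le_iff₀ half_dφ_pos] at h₄
  have hl : level h + 1 ≤ 2 * n := by
    have := h.2.1.2
    have := Bool.toNat_le h.2.2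
    unfold level
    omega
  have hd := half_dφ_pos (P := P) (n := n)
  refine ⟨⟨(R₀_le_rad (Nat.cast_nonneg _)).trans h₁, h₂.trans ?_⟩, le_trans (by positivity) h₃,
    h₄.trans ?_⟩
  · rw [← rad_n (n := n)]
    exact rad_le_rad_iff.2 (cast_add_one_le _)
  · calc ((level h : ℝ) + 1) * (P.dφ n / 2)
        ≤ (2 * n) * (P.dφ n / 2) := by gcongr; exact_mod_cast hl
      _ = P.ε / P.b := by rw [← n_mul_dφ (n := n)]; ring

theorem isClosed_halfCell (h : Label n) : IsClosed (P.halfCell n h) := by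
  have h₁ : Continuous (P.col n) := by unfold col; fun_prop
  have h₂ : Continuous (P.row n) := by unfold row; fun_prop
  exact (isClosed_Icc.preimage (h₁.comp continuous_fst)).inter
    (isClosed_Icc.preimage (h₂.comp continuous_snd))

theorem chartF_eq (h : Label n) (x : ℝ × ℝ) : P.chartF n h x =
    (x.1 - P.rad n h.1, (x.2 - P.baseAngle n h) * P.factor n h.1 x.1) := rfl

theorem chartF_mem_hex {h : Label n} {x : ℝ × ℝ} (hx : x ∈ P.halfCell n h) :
    P.chartF n h x ∈ P.hex n h := by
  have hf := factor_nonneg (P := P) (n := n) h.1 x.1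
  have hr₀ := le_col_iff.1 hx.1.1
  have hr₁ := col_le_iff.1 hx.1.2
  have hφ := side_mul_sub_mem_Icc.2 hx.2
  have := rad_sub_rad (P := P) (n := n) (h.1 + 1) h.1
  rw [mem_hex, chartF_eq, add_sub_cancel, ← mul_assoc]
  exact ⟨⟨by linarith, by linarith⟩, mul_nonneg hφ.1 hf, mul_le_mul_of_nonneg_right hφ.2 hf⟩

/-! ### Independence of the label -/

theorem eq_or_succ_of_mem_Icc {i i' : ℕ} {t : ℝ} (h : t ∈ Icc (i : ℝ) (i + 1))
    (h' : t ∈ Icc (i' : ℝ) (i' + 1)) (hle : i ≤ i') : i = i' ∨ i' = i + 1 ∧ t = i' := by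
  have : i' ≤ i + 1 := by exact_mod_cast h'.1.trans h.2
  rcases hle.eq_or_lt with rfl | hlt
  · exact .inl rfl
  · obtain rfl : i' = i + 1 := by omega
    exact .inr ⟨rfl, le_antisymm (by exact_mod_cast h.2) h'.1⟩

theorem mk_chartF_eq_of_column (hD : P.D n ≤ 1 / 2) {i i' j : Fin n} {up : Bool} {x : ℝ × ℝ}
    (h : x ∈ P.halfCell n (i, j, up)) (h' : x ∈ P.halfCell n (i', j, up)) :
    (Quot.mk _ ⟨_, _, chartF_mem_hex h⟩ : P.Surface n) = Quot.mk _ ⟨_, _, chartF_mem_hex h'⟩ := by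
  wlog hle : (i : ℕ) ≤ i' generalizing i i'
  · exact (this h' h (le_of_not_ge hle)).symm
  obtain heq | ⟨hi, ht⟩ := eq_or_succ_of_mem_Icc h.1 h'.1 hle
  · obtain rfl : i = i' := Fin.ext heq
    rfl
  have hDpos := D_pos (P := P) (n := n)
  have hi' : (i' : ℝ) = i + 1 := by exact_mod_cast hi
  have hx : x.1 = P.rad n i' := by rw [← ht, rad_col]
  have e : P.chartF n (i, j, up) x =
      (P.bCell n, (x.2 - P.baseAngle n (i', j, up)) * P.rad n i') := by
    rw [chartF_eq, factor_eq_rad, ht, ramp_of_ge hDpos (by linarith), hx, rad_sub_rad, hi']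
    simp [baseAngle]
  have e' : P.chartF n (i', j, up) x =
      (0, (x.2 - P.baseAngle n (i', j, up)) * P.rad n i') := by
    rw [chartF_eq, factor_eq_rad, ht, ramp_of_le hDpos (by linarith), hx, sub_self, add_zero]
  simp only [e, e']
  exact Quot.sound (.horiz i i' j hi up _ (e ▸ chartF_mem_hex h) (e' ▸ chartF_mem_hex h'))

theorem eq_of_level_eq {i i' j j' : Fin n} {up up' : Bool}
    (h : level (i, j, up) = level (i', j', up')) : j = j' ∧ up = up' := by
  cases up <;> cases up' <;> simp only [level, Bool.toNat_false, Bool.toNat_true] at h <;>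
    first | omega | exact ⟨Fin.ext (by omega), rfl⟩

theorem mk_chartF_eq_of_row {i j j' : Fin n} {up up' : Bool} {x : ℝ × ℝ}
    (h : x ∈ P.halfCell n (i, j, up)) (h' : x ∈ P.halfCell n (i, j', up')) :
    (Quot.mk _ ⟨_, _, chartF_mem_hex h⟩ : P.Surface n) = Quot.mk _ ⟨_, _, chartF_mem_hex h'⟩ := by
  wlog hle : level (i, j, up) ≤ level (i, j', up') generalizing j j' up up'
  · exact (this h' h (le_of_not_ge hle)).symm
  have hd := half_dφ_pos (P := P) (n := n)
  obtain heq | ⟨hl, ht⟩ := eq_or_succ_of_mem_Icc h.2 h'.2 hle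
  · obtain ⟨rfl, rfl⟩ := eq_of_level_eq heq
    rfl
  rw [row, div_eq_iff hd.ne'] at ht
  cases up <;> cases up' <;>
    simp only [level, Bool.toNat_false, Bool.toNat_true] at hl ht <;> try omega
  · obtain rfl : j = j' := Fin.ext (by omega)
    push_cast at ht
    have hx : x.2 = P.ang n j + P.dφ n / 2 := by
      rw [ht, ang]
      ring
    have e : P.chartF n (i, j, false) x = (x.1 - P.rad n i, P.dφ n / 2 * P.factor n i x.1) := by
      simp [chartF_eq, baseAngle, hx]
    have e' : P.chartF n (i, j, true) x = (x.1 - P.rad n i, -(P.dφ n / 2 * P.factor n i x.1)) := by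
      rw [chartF_eq, ← neg_mul]
      simp only [baseAngle, hx, ang, if_true]
      ring_nf
    simp only [e, e']
    exact Quot.sound (.mid i j _ _ _ (factor_eq _ _) rfl (e ▸ chartF_mem_hex h)
      (e' ▸ chartF_mem_hex h'))
  · have hj : (j' : ℕ) = j + 1 := by omega
    have hx : x.2 = P.ang n (j + 1) := by
      rw [ht, hj, ang]
      push_cast
      ring
    have e : P.chartF n (i, j, true) x = (x.1 - P.rad n i, 0) := by
      simp [chartF_eq, baseAngle, hx]
    have e' : P.chartF n (i, j', false) x = (x.1 - P.rad n i, 0) := by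
      simp [chartF_eq, baseAngle, hx, hj]
    simp only [e, e']
    exact Quot.sound (.vert i j j' hj _ (e ▸ chartF_mem_hex h) (e' ▸ chartF_mem_hex h'))

theorem F_eq (hD : P.D n ≤ 1 / 2) (x : P.sector) {h : Label n} (hx : x.1 ∈ P.halfCell n h) :
    P.F n x = Quot.mk _ ⟨h, _, chartF_mem_hex hx⟩ := by
  have hl := label_mem (n := n) x.2
  have hmid : x.1 ∈ P.halfCell n (h.1, (P.label n x).2) := ⟨hx.1, hl.2⟩
  exact (mk_chartF_eq_of_column hD hl hmid).trans (mk_chartF_eq_of_row hmid hx)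

/-! ### The upper bound for the distance of the surface -/

theorem surfaceArc_nonneg (p q : P.Surface n) (L : ℝ) (h : P.surfaceArc n p q L) : 0 ≤ L := by
  obtain ⟨_, _, _, _, _, h⟩ := h
  exact h.nonneg fun _ => flatNorm_nonneg

/-- One of the two convex polygons into which the vertical line through the singular point
`p₋` cuts the hexagon with label `h`. -/
def hexPiece (P : Params) (n : ℕ+) (h : Label n) (right : Bool) : Set (ℝ × ℝ) :=
  {x ∈ P.hex n h | x.1 / P.bCell n ∈ kinkSide (P.D n) right}

theorem factor_rad_add (i : ℕ) (X : ℝ) : P.factor n i (P.rad n i + X) =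
    P.rad n i + ramp (P.D n) (X / P.bCell n) * P.bCell n := by
  have hcol : P.col n (P.rad n i + X) - i = X / P.bCell n := by
    rw [← col_rad (P := P) (n := n) i, rad_col, col_sub_col, add_sub_cancel_left]
  rw [factor_eq_rad, hcol]
  unfold rad
  ring

theorem convex_hexPiece (h : Label n) (right : Bool) : Convex ℝ (P.hexPiece n h right) := by
  rintro x ⟨hx, hxr⟩ y ⟨hy, hyr⟩ c d hc hd hcd
  have hb := bCell_pos (P := P) (n := n)
  have hdφ := dφ_pos (P := P) (n := n)
  have hconc := concaveOn_ramp (D_pos (P := P) (n := n)) right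
  have hz : (c • x + d • y).1 / P.bCell n =
      c • (x.1 / P.bCell n) + d • (y.1 / P.bCell n) := by
    simp only [Prod.fst_add, Prod.smul_fst, smul_eq_mul]
    ring
  rw [mem_hex, factor_rad_add] at hx hy
  refine ⟨mem_hex.2 ⟨convex_Icc 0 (P.bCell n) hx.1 hy.1 hc hd hcd, ?_⟩,
    hz ▸ hconc.1 hxr hyr hc hd hcd⟩
  have hside : side h.2.2 * (c • x + d • y).2 =
      c * (side h.2.2 * x.2) + d * (side h.2.2 * y.2) := by
    simp only [Prod.snd_add, Prod.smul_snd, smul_eq_mul]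
    ring
  rw [factor_rad_add, hside, hz]
  have hramp := hconc.2 hxr hyr hc hd hcd
  rw [smul_eq_mul, smul_eq_mul] at hramp
  refine ⟨add_nonneg (mul_nonneg hc hx.2.1) (mul_nonneg hd hy.2.1), ?_⟩
  generalize ramp (P.D n) (_ + _) = ρ at *
  generalize ramp (P.D n) (x.1 / P.bCell n) = ρx at *
  generalize ramp (P.D n) (y.1 / P.bCell n) = ρy at *
  calc c * (side h.2.2 * x.2) + d * (side h.2.2 * y.2)
      ≤ c * (P.dφ n / 2 * (P.rad n h.1 + ρx * P.bCell n)) +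
          d * (P.dφ n / 2 * (P.rad n h.1 + ρy * P.bCell n)) :=
        add_le_add (mul_le_mul_of_nonneg_left hx.2.2 hc) (mul_le_mul_of_nonneg_left hy.2.2 hd)
    _ = P.dφ n / 2 * ((c + d) * P.rad n h.1 + (c * ρx + d * ρy) * P.bCell n) := by ring
    _ ≤ P.dφ n / 2 * (P.rad n h.1 + ρ * P.bCell n) := by rw [hcd, one_mul]; gcongr

theorem surfaceArc_segment {h : Label n} {right : Bool} {x y : P.hex n h}
    (hx : x.1 ∈ P.hexPiece n h right) (hy : y.1 ∈ P.hexPiece n h right) :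
    P.surfaceArc n (Quot.mk _ ⟨h, x⟩) (Quot.mk _ ⟨h, y⟩) (flatNorm (y - x)) :=
  ⟨h, x, y, rfl, rfl, (isArc_flat_segment (convex_hexPiece h right) hx hy).mono fun _ hz => hz.1⟩

/-- A bound for the distance of two points of the same hexagon. -/
def hexDiam (P : Params) (n : ℕ+) : ℝ := 2 * (P.bCell n + P.dφ n / 2 * P.R₁)

/-- Both convex pieces of the hexagon contain the point below or above `p₋`. -/
theorem exists_chain_hex (hD : P.D n ≤ 1) {h : Label n} (x y : P.hex n h) :
    ∃ L ≤ P.hexDiam n, Chain (P.surfaceArc n) (Quot.mk _ ⟨h, x⟩) (Quot.mk _ ⟨h, y⟩) L := by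
  have hb := bCell_pos (P := P) (n := n)
  have hd := half_dφ_pos (P := P) (n := n)
  have hD₀ := D_pos (P := P) (n := n)
  have hk : ((1 - P.D n) / 2 * P.bCell n, (0 : ℝ)) ∈ P.hex n h :=
    mem_hex.2 ⟨⟨by nlinarith, by nlinarith⟩, by simp, by
      simpa using mul_nonneg hd.le (factor_nonneg _ _)⟩
  have hk' (right : Bool) : ((1 - P.D n) / 2 * P.bCell n, (0 : ℝ)) ∈ P.hexPiece n h right :=
    ⟨hk, by rw [mul_div_cancel_right₀ _ hb.ne']; exact kink_mem_kinkSide _ _⟩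
  have hnorm (z : P.hex n h) : flatNorm (z - ((1 - P.D n) / 2 * P.bCell n, (0 : ℝ))) ≤
      P.bCell n + P.dφ n / 2 * P.R₁ := by
    obtain ⟨hz₁, hz₂⟩ := mem_hex.1 z.2
    refine (flatNorm_le_add _).trans (add_le_add ?_ ?_)
    · simpa using abs_sub_le_of_le_of_le hz₁.1 hz₁.2 (mem_hex.1 hk).1.1 (mem_hex.1 hk).1.2
    · rw [Prod.snd_sub, sub_zero, ← abs_side_mul h.2.2, abs_of_nonneg hz₂.1, ← rad_n (n := n)]
      refine hz₂.2.trans (mul_le_mul_of_nonneg_left ((factor_mem_Icc _ _).2.trans ?_) hd.le)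
      exact rad_le_rad_iff.2 (cast_add_one_le _)
  obtain ⟨right, hx⟩ := exists_mem_kinkSide (P.D n) (x.1.1 / P.bCell n)
  obtain ⟨right', hy⟩ := exists_mem_kinkSide (P.D n) (y.1.1 / P.bCell n)
  refine ⟨_, ?_, (Chain.single (surfaceArc_segment (y := ⟨_, hk⟩) ⟨x.2, hx⟩ (hk' right))).trans
    (.single (surfaceArc_segment (hk' right') ⟨y.2, hy⟩))⟩
  rw [flatNorm_sub_comm, hexDiam, two_mul]
  exact add_le_add (hnorm x) (hnorm y)

end Params

theorem eventually_exists_mem_closed_cover {ι α : Type*} [Finite ι] [TopologicalSpace α]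
    {C : ι → Set α} (hC : ∀ i, IsClosed (C i)) (hcover : ∀ x, ∃ i, x ∈ C i) (x : α) :
    ∀ᶠ y in 𝓝 x, ∃ i, x ∈ C i ∧ y ∈ C i := by
  filter_upwards [(locallyFinite_of_finite C).eventually_subset hC x] with y hy
  obtain ⟨i, hi⟩ := hcover y
  exact ⟨i, hy hi, hi⟩

namespace Params

variable {P : Params} {n : ℕ+}

theorem exists_chain_F (hD : P.D n ≤ 1 / 2) {h : Label n} {x y : P.sector}
    (hx : x.1 ∈ P.halfCell n h) (hy : y.1 ∈ P.halfCell n h) :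
    ∃ L ≤ P.hexDiam n, Chain (P.surfaceArc n) (P.F n x) (P.F n y) L := by
  rw [F_eq hD x hx, F_eq hD y hy]
  exact exists_chain_hex (by linarith) _ _

theorem surfaceDist_F_le_hexDiam (hD : P.D n ≤ 1 / 2) {h : Label n} {x y : P.sector}
    (hx : x.1 ∈ P.halfCell n h) (hy : y.1 ∈ P.halfCell n h) :
    P.surfaceDist n (P.F n x) (P.F n y) ≤ P.hexDiam n := by
  obtain ⟨L, hL, hchain⟩ := exists_chain_F hD hx hy
  exact (pathDist_le surfaceArc_nonneg hchain).trans hL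

theorem reachable_F (hD : P.D n ≤ 1 / 2) (x y : P.sector) :
    Reachable (P.surfaceArc n) (P.F n x) (P.F n y) := by
  have := Subtype.preconnectedSpace (convex_sector (P := P)).isPreconnected
  have : IsTrans P.sector fun x y => Reachable (P.surfaceArc n) (P.F n x) (P.F n y) :=
    ⟨fun _ _ _ => Reachable.trans⟩
  refine PreconnectedSpace.induction₂' (fun x y => Reachable (P.surfaceArc n) (P.F n x) (P.F n y))
    (fun x => ?_) this x y
  filter_upwards [eventually_exists_mem_closed_cover
    (fun h => (isClosed_halfCell h).preimage continuous_subtype_val)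
    (fun y : P.sector => ⟨P.label n y, label_mem y.2⟩) x] with y ⟨h, hx, hy⟩
  obtain ⟨L, -, hxy⟩ := exists_chain_F hD hx hy
  obtain ⟨L', -, hyx⟩ := exists_chain_F hD hy hx
  exact ⟨⟨L, hxy⟩, ⟨L', hyx⟩⟩

theorem surfaceDist_F_triangle (hD : P.D n ≤ 1 / 2) (x y z : P.sector) :
    P.surfaceDist n (P.F n x) (P.F n z) ≤
      P.surfaceDist n (P.F n x) (P.F n y) + P.surfaceDist n (P.F n y) (P.F n z) :=
  pathDist_triangle surfaceArc_nonneg (reachable_F hD x y) (reachable_F hD y z)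

/-- The relative width of the zone of each column that `squeeze` maps to the middle zone, of
relative width `D`. -/
def root (P : Params) (n : ℕ+) : ℝ := √(P.D n)

theorem root_pos : 0 < P.root n := Real.sqrt_pos.2 D_pos

theorem root_sq : P.root n ^ 2 = P.D n := Real.sq_sqrt D_pos.le

theorem root_le_one (hD : P.D n ≤ 1 / 2) : P.root n ≤ 1 := Real.sqrt_le_one.2 (by linarith)

/-- A radial map of every half-cell to itself.  Its composition with `F` stretches lengths by a
factor of at most `lipF`, which tends to `1`, whereas the Lipschitz constants of `F` itself stay
away from `1`: the middle zones, of relative width `D`, are too narrow. -/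
def squeeze (P : Params) (n : ℕ+) (x : ℝ × ℝ) : ℝ × ℝ :=
  (P.rad n (compress (P.root n) (P.col n x.1)), x.2)

theorem compress_col (h : Label n) (x : ℝ × ℝ) : compress (P.root n) (P.col n x.1) =
    (h.1 : ℕ) + compress (P.root n) (P.col n x.1 - (h.1 : ℕ)) := by
  rw [← compress_natCast_add, add_sub_cancel]

theorem col_sub_mem_Icc {h : Label n} {x : ℝ × ℝ} (hx : x ∈ P.halfCell n h) :
    P.col n x.1 - (h.1 : ℕ) ∈ Icc (0 : ℝ) 1 :=
  ⟨sub_nonneg.2 hx.1.1, sub_le_iff_le_add'.2 hx.1.2⟩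

theorem squeeze_mem_halfCell (hD : P.D n ≤ 1 / 2) {h : Label n} {x : ℝ × ℝ}
    (hx : x ∈ P.halfCell n h) : P.squeeze n x ∈ P.halfCell n h := by
  have hs := compress_mem_Icc root_pos (root_le_one hD) (col_sub_mem_Icc hx)
  refine ⟨?_, hx.2⟩
  rw [squeeze, col_rad, compress_col h]
  exact ⟨le_add_of_nonneg_right hs.1, add_le_add_right hs.2 _⟩

theorem squeeze_mem_sector (hD : P.D n ≤ 1 / 2) {x : ℝ × ℝ} (hx : x ∈ P.sector) :
    P.squeeze n x ∈ P.sector :=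
  halfCell_subset_sector _ (squeeze_mem_halfCell hD (label_mem (n := n) hx))

theorem chartF_squeeze (hD : P.D n ≤ 1 / 2) {h : Label n} {x : ℝ × ℝ} (hx : x ∈ P.halfCell n h) :
    P.chartF n h (P.squeeze n x) =
      (compress (P.root n) (P.col n x.1 - (h.1 : ℕ)) * P.bCell n,
        (x.2 - P.baseAngle n h) *
          P.rad n ((h.1 : ℕ) + ramp (P.root n) (P.col n x.1 - (h.1 : ℕ)))) := by
  rw [chartF_eq, factor_eq_rad, squeeze, col_rad, rad_sub_rad, compress_col h,
    add_sub_cancel_left, ← root_sq, ramp_compress root_pos (root_le_one hD) (col_sub_mem_Icc hx)]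

/-- A Lipschitz constant of the composition of `F` with `squeeze`. -/
def lipF (P : Params) (n : ℕ+) : ℝ :=
  (1 + P.root n) * P.ratio n + Real.tan P.θ * P.root n

theorem abs_sub_baseAngle_le {h : Label n} {x : ℝ × ℝ} (hx : x ∈ P.halfCell n h) :
    |x.2 - P.baseAngle n h| ≤ P.dφ n / 2 := by
  have hφ := side_mul_sub_mem_Icc.2 hx.2
  rw [← abs_side_mul h.2.2, abs_of_nonneg hφ.1]
  exact hφ.2

theorem abs_rad_ramp_sub_le {w : ℝ} (hw : 0 < w) (i r r' : ℝ) :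
    |P.rad n (i + ramp w (P.col n r' - i)) - P.rad n (i + ramp w (P.col n r - i))| ≤
      |r' - r| / w := by
  have hb := bCell_pos (P := P) (n := n)
  have hramp := abs_ramp_sub_le hw (P.col n r' - i) (P.col n r - i)
  rw [sub_sub_sub_cancel_right, col_sub_col, abs_div, abs_of_pos hb] at hramp
  rw [rad_sub_rad, add_sub_add_left_eq_sub, abs_mul, abs_of_pos hb, ← le_div_iff₀ hb]
  exact hramp.trans_eq (div_right_comm _ _ _)

theorem abs_rad_ramp_le_ratio_mul {i r : ℝ} (hi : 0 ≤ i) (h : P.rad n i ≤ r) (w s : ℝ) :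
    |P.rad n (i + ramp w s)| ≤ P.ratio n * |r| := by
  have hs := ramp_mem_Icc w s
  rw [abs_of_pos (rad_pos (add_nonneg hi hs.1)), abs_of_pos ((rad_pos hi).trans_le h)]
  exact (rad_le_rad_iff.2 (add_le_add_right hs.2 _)).trans (rad_add_one_le_ratio_mul hi h)

theorem flatNorm_chartF_squeeze_sub_le (hD : P.D n ≤ 1 / 2) {h : Label n} {x y : ℝ × ℝ}
    (hx : x ∈ P.halfCell n h) (hy : y ∈ P.halfCell n h) :
    flatNorm (P.chartF n h (P.squeeze n y) - P.chartF n h (P.squeeze n x)) ≤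
      P.lipF n * polarNorm x (y - x) := by
  have he := root_pos (P := P) (n := n)
  have hb := bCell_pos (P := P) (n := n)
  have hdφ := half_dφ_pos (P := P) (n := n)
  have htan := tan_pos P
  have hratio := one_le_ratio (P := P) (n := n)
  rw [flatNorm_eq_polarNorm, chartF_squeeze hD hx, chartF_squeeze hD hy, lipF]
  refine polarNorm_le_of_nearly_diagonal (by positivity) (by positivity) ?_ ?_
  · have hcompress := abs_compress_sub_le he (root_le_one hD) (col_sub_mem_Icc hy)
      (col_sub_mem_Icc hx)
    rw [sub_sub_sub_cancel_right, col_sub_col, abs_div, abs_of_pos hb, ← mul_div_assoc,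
      le_div_iff₀ hb] at hcompress
    rw [Prod.fst_sub, ← sub_mul, abs_mul, abs_of_pos hb, mul_right_comm]
    exact hcompress.trans (le_mul_of_one_le_right (by positivity) hratio)
  · have hρ := abs_rad_ramp_le_ratio_mul (Nat.cast_nonneg _) (le_col_iff.1 hx.1.1) (P.root n)
      (P.col n x.1 - (h.1 : ℕ))
    have hρρ' := abs_rad_ramp_sub_le (P := P) (n := n) he (h.1 : ℕ) x.1 y.1
    have hbase := abs_sub_baseAngle_le hy
    generalize P.rad n (_ + ramp _ (P.col n x.1 - _)) = ρ at *
    generalize P.rad n (_ + ramp _ (P.col n y.1 - _)) = ρ' at *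
    calc |1 * ((y.2 - P.baseAngle n h) * ρ' - (x.2 - P.baseAngle n h) * ρ)|
        = |(y.2 - x.2) * ρ + (y.2 - P.baseAngle n h) * (ρ' - ρ)| := by ring_nf
      _ ≤ |y.2 - x.2| * |ρ| + |y.2 - P.baseAngle n h| * |ρ' - ρ| :=
          (abs_add_le _ _).trans_eq (by rw [abs_mul, abs_mul])
      _ ≤ |y.2 - x.2| * (P.ratio n * |x.1|) + P.dφ n / 2 * (|y.1 - x.1| / P.root n) := by gcongr
      _ = 1 * (P.ratio n * |x.1 * (y.2 - x.2)|) + Real.tan P.θ * P.root n * |y.1 - x.1| := by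
          rw [half_dφ_eq, ← root_sq, abs_mul]
          field_simp
      _ ≤ (1 + P.root n) * P.ratio n * |x.1 * (y.2 - x.2)| +
            Real.tan P.θ * P.root n * |y.1 - x.1| := by
          rw [mul_assoc (1 + P.root n)]
          gcongr
          linarith

/-- The part of a half-cell that the composition of `F` with `squeeze` maps to one of the two
convex pieces of a hexagon. -/
def squeezeCell (P : Params) (n : ℕ+) (c : Label n × Bool) : Set (ℝ × ℝ) :=
  {x ∈ P.halfCell n c.1 | P.col n x.1 - (c.1.1 : ℕ) ∈ kinkSide (P.root n) c.2}

theorem isClosed_squeezeCell (c : Label n × Bool) : IsClosed (P.squeezeCell n c) := by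
  have hcol : Continuous (P.col n) := by unfold col; fun_prop
  exact (isClosed_halfCell c.1).inter
    ((isClosed_kinkSide (P.root n) c.2).preimage (by fun_prop :
      Continuous fun x : ℝ × ℝ => P.col n x.1 - (c.1.1 : ℕ)))

theorem exists_mem_squeezeCell {x : ℝ × ℝ} (hx : x ∈ P.sector) :
    ∃ c, x ∈ P.squeezeCell n c := by
  obtain ⟨right, hright⟩ := exists_mem_kinkSide (P.root n) (P.col n x.1 - ((P.label n x).1 : ℕ))
  exact ⟨(P.label n x, right), label_mem hx, hright⟩

theorem chartF_squeeze_mem_hexPiece (hD : P.D n ≤ 1 / 2) {c : Label n × Bool} {x : ℝ × ℝ}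
    (hx : x ∈ P.squeezeCell n c) : P.chartF n c.1 (P.squeeze n x) ∈ P.hexPiece n c.1 c.2 := by
  refine ⟨chartF_mem_hex (squeeze_mem_halfCell hD hx.1), ?_⟩
  rw [chartF_squeeze hD hx.1, mul_div_cancel_right₀ _ bCell_pos.ne', ← root_sq]
  exact compress_mem_kinkSide root_pos (root_le_one hD) (col_sub_mem_Icc hx.1) hx.2

/-- The distance, in the surface, of the images of two points under the composition of `F` with
`squeeze`. -/
def squeezeDist (hD : P.D n ≤ 1 / 2) (x y : P.sector) : ℝ :=
  P.surfaceDist n (P.F n ⟨_, squeeze_mem_sector hD x.2⟩) (P.F n ⟨_, squeeze_mem_sector hD y.2⟩)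

theorem squeezeDist_le (hD : P.D n ≤ 1 / 2) {c : Label n × Bool} {x y : P.sector}
    (hx : x.1 ∈ P.squeezeCell n c) (hy : y.1 ∈ P.squeezeCell n c) :
    squeezeDist hD x y ≤
      flatNorm (P.chartF n c.1 (P.squeeze n y) - P.chartF n c.1 (P.squeeze n x)) := by
  rw [squeezeDist, F_eq hD _ (squeeze_mem_halfCell hD hx.1),
    F_eq hD _ (squeeze_mem_halfCell hD hy.1)]
  exact pathDist_le surfaceArc_nonneg (.single (surfaceArc_segment
    (chartF_squeeze_mem_hexPiece hD hx) (chartF_squeeze_mem_hexPiece hD hy)))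

theorem squeezeDist_le_mul_sectorDist (hD : P.D n ≤ 1 / 2) (x y : P.sector) :
    squeezeDist hD x y ≤ P.lipF n * P.sectorDist x y := by
  have hlip : 0 < P.lipF n := by
    have := root_pos (P := P) (n := n)
    have := one_le_ratio (P := P) (n := n)
    have := tan_pos P
    unfold lipF
    positivity
  have hself (x : P.sector) : squeezeDist hD x x ≤ 0 := pathDist_le surfaceArc_nonneg (.nil _)
  have htri (x y z : P.sector) : squeezeDist hD x z ≤ squeezeDist hD x y + squeezeDist hD y z :=
    surfaceDist_F_triangle hD _ _ _
  refine le_mul_pathDist hlip hself htri (fun _ _ _ => IsArc.le_mul_of_eventually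
    isLengthElement_polarNorm hself htri fun x => ?_) (reachable_sector x y)
  filter_upwards [eventually_exists_mem_closed_cover
    (fun c => (isClosed_squeezeCell (P := P) (n := n) c).preimage continuous_subtype_val)
    (fun y : P.sector => exists_mem_squeezeCell y.2) x] with y ⟨c, hx, hy⟩
  have hbound := flatNorm_chartF_squeeze_sub_le hD hx.1 hy.1
  refine ⟨(squeezeDist_le hD hx hy).trans hbound, (squeezeDist_le hD hy hx).trans ?_⟩
  rwa [flatNorm_sub_comm]

theorem surfaceDist_F_le (hD : P.D n ≤ 1 / 2) (x y : P.sector) :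
    P.surfaceDist n (P.F n x) (P.F n y) ≤ P.lipF n * P.sectorDist x y + 2 * P.hexDiam n := by
  let sq (z : P.sector) : P.sector := ⟨_, squeeze_mem_sector hD z.2⟩
  have hx : P.surfaceDist n (P.F n x) (P.F n (sq x)) ≤ P.hexDiam n :=
    surfaceDist_F_le_hexDiam hD (label_mem x.2) (squeeze_mem_halfCell hD (label_mem x.2))
  have hy : P.surfaceDist n (P.F n (sq y)) (P.F n y) ≤ P.hexDiam n :=
    surfaceDist_F_le_hexDiam hD (squeeze_mem_halfCell hD (label_mem y.2)) (label_mem y.2)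
  have hxy : P.surfaceDist n (P.F n (sq x)) (P.F n (sq y)) ≤ P.lipF n * P.sectorDist x y :=
    squeezeDist_le_mul_sectorDist hD x y
  linarith [surfaceDist_F_triangle hD x (sq x) y, surfaceDist_F_triangle hD (sq x) (sq y) y]

/-! ### The lower bound for the distance of the surface -/

/-- The number by which the second coordinate in a hexagon is divided to obtain an angle.  It runs
from `r_i` to `r_{i+1}` like `factor`, to which it is a lower bound, but its slope stays bounded. -/
def divisor (P : Params) (n : ℕ+) (i : ℕ) (X : ℝ) : ℝ := P.rad n i + max 0 (2 * X - P.bCell n)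

theorem divisor_le_factor (hD : P.D n ≤ 1 / 2) (i : ℕ) {X : ℝ} (hX : X ≤ P.bCell n) :
    P.divisor n i X ≤ P.factor n i (P.rad n i + X) := by
  have hb := bCell_pos (P := P) (n := n)
  have hramp := mul_le_mul_of_nonneg_right
    (le_ramp D_pos hD ((div_le_one hb).2 hX)) hb.le
  rw [sub_mul, mul_assoc, div_mul_cancel₀ _ hb.ne', one_mul] at hramp
  rw [factor_rad_add, divisor]
  gcongr
  exact max_le (mul_nonneg (ramp_mem_Icc _ _).1 hb.le) hramp

theorem abs_divisor_sub_le (i : ℕ) (X X' : ℝ) :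
    |P.divisor n i X - P.divisor n i X'| ≤ 2 * |X - X'| := by
  calc |P.divisor n i X - P.divisor n i X'|
      ≤ |2 * X - P.bCell n - (2 * X' - P.bCell n)| := by
        rw [divisor, divisor, add_sub_add_left_eq_sub]
        simpa using abs_max_sub_max_le_max 0 (2 * X - P.bCell n) 0 (2 * X' - P.bCell n)
    _ = 2 * |X - X'| := by rw [sub_sub_sub_cancel_right, ← mul_sub, abs_mul, abs_two]

/-- The left inverse of `chartF`, up to an error that tends to `0`, on the hexagon with
label `h`. -/
def chartG (P : Params) (n : ℕ+) (h : Label n) (x : ℝ × ℝ) : ℝ × ℝ :=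
  (P.rad n h.1 + x.1,
    P.baseAngle n h +
      side h.2.2 * min (P.dφ n / 2) (side h.2.2 * x.2 / P.divisor n h.1 x.1))

theorem divisor_pos (i : ℕ) (X : ℝ) : 0 < P.divisor n i X :=
  add_pos_of_pos_of_nonneg (rad_pos (Nat.cast_nonneg _)) (le_max_left _ _)

theorem chartG_mem_halfCell {h : Label n} {x : ℝ × ℝ} (hx : x ∈ P.hex n h) :
    P.chartG n h x ∈ P.halfCell n h := by
  obtain ⟨hX, hY⟩ := mem_hex.1 hx
  have := rad_sub_rad (P := P) (n := n) (h.1 + 1) h.1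
  refine ⟨⟨le_col_iff.2 (le_add_of_nonneg_right hX.1), col_le_iff.2 ?_⟩,
    side_mul_sub_mem_Icc.1 ?_⟩
  · rw [chartG]
    linarith [hX.2]
  · rw [chartG, add_sub_cancel_left, ← mul_assoc, side_mul_side, one_mul]
    exact ⟨le_min half_dφ_pos.le (div_nonneg hY.1 (divisor_pos _ _).le), min_le_left _ _⟩

/-- `chartG` as a map from the disjoint union of the hexagons to the sector. -/
def pieceG (p : P.Pieces n) : P.sector :=
  ⟨_, halfCell_subset_sector _ (chartG_mem_halfCell p.2.2)⟩

theorem chartG_of_eq_height (hD : P.D n ≤ 1 / 2) {h : Label n} {X Y : ℝ}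
    (hX : X ≤ P.bCell n)
    (hY : side h.2.2 * Y = height (P.aCell n h.1) (P.bCell n) P.θ (P.εCell n) X) :
    P.chartG n h (X, Y) = (P.rad n h.1 + X, P.baseAngle n h + side h.2.2 * (P.dφ n / 2)) := by
  rw [chartG, hY, height_eq, min_eq_left]
  rw [le_div_iff₀ (divisor_pos _ _)]
  exact mul_le_mul_of_nonneg_left (divisor_le_factor hD _ hX) half_dφ_pos.le

theorem pieceG_eq_of_glue (hD : P.D n ≤ 1 / 2) {p q : P.Pieces n} (hpq : P.Glue n p q) :
    pieceG p = pieceG q := by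
  refine Subtype.ext ?_
  cases hpq with
  | mid i j X Y Y' hY hY' h h' =>
    have hX := (mem_hex.1 h).1.2
    simp only [pieceG]
    rw [chartG_of_eq_height hD hX (by simpa [side] using hY),
      chartG_of_eq_height hD hX (by simpa [side, hY'] using hY)]
    simp only [baseAngle, side, ang, if_true, Bool.false_eq_true, if_false]
    ring_nf
  | vert i j j' hj X h h' => simp [pieceG, chartG, baseAngle, hj, half_dφ_pos.le]
  | horiz i i' j hi up Y h h' =>
    have hb := bCell_pos (P := P) (n := n)
    have hrad : P.rad n i + P.bCell n = P.rad n i' := by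
      rw [hi, rad, rad]
      push_cast
      ring
    have hdivisor : P.divisor n i (P.bCell n) = P.divisor n i' 0 := by
      rw [divisor, divisor, ← hrad, max_eq_right (by linarith), max_eq_left (by linarith)]
      ring
    simp only [pieceG, chartG, hrad, hdivisor, add_zero, baseAngle]

/-- The map from the surface to the sector given by `chartG`. -/
def G (hD : P.D n ≤ 1 / 2) : P.Surface n → P.sector :=
  Quot.lift pieceG fun _ _ => pieceG_eq_of_glue hD

/-- A Lipschitz constant of `G`. -/
def lipG (P : Params) (n : ℕ+) : ℝ := P.ratio n + P.ratio n ^ 2 * P.dφ n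

theorem abs_div_divisor_sub_le {i : ℕ} {X X' Y Y' : ℝ}
    (hY : |Y| ≤ P.dφ n / 2 * P.rad n (i + 1)) :
    |Y' / P.divisor n i X' - Y / P.divisor n i X| ≤
      |Y' - Y| / P.rad n i + P.dφ n * P.rad n (i + 1) / P.rad n i ^ 2 * |X' - X| := by
  have hr : 0 < P.rad n i := rad_pos (Nat.cast_nonneg _)
  have hρ : P.rad n i ≤ P.divisor n i X := le_add_of_nonneg_right (le_max_left _ _)
  have hρ' : P.rad n i ≤ P.divisor n i X' := le_add_of_nonneg_right (le_max_left _ _)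
  have hdiff := abs_divisor_sub_le (P := P) (n := n) i X X'
  generalize P.divisor n i X = ρ at *
  generalize P.divisor n i X' = ρ' at *
  have hρ₀ := hr.trans_le hρ
  have hρ₀' := hr.trans_le hρ'
  have hY₀ := (abs_nonneg Y).trans hY
  calc |Y' / ρ' - Y / ρ|
      = |(Y' - Y) / ρ' + Y * (ρ - ρ') / (ρ * ρ')| := by
        congr 1
        field_simp
        ring
    _ ≤ |Y' - Y| / ρ' + |Y| * |ρ - ρ'| / (ρ * ρ') := by
        refine (abs_add_le _ _).trans_eq ?_
        rw [abs_div, abs_div, abs_mul, abs_of_pos hρ₀', abs_of_pos (mul_pos hρ₀ hρ₀')]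
    _ ≤ |Y' - Y| / P.rad n i + P.dφ n / 2 * P.rad n (i + 1) * (2 * |X - X'|) /
          (P.rad n i * P.rad n i) := by gcongr
    _ = _ := by
        rw [abs_sub_comm X]
        ring

theorem sectorDist_pieceG_le {h : Label n} (x y : P.hex n h) :
    P.sectorDist (pieceG ⟨h, x⟩) (pieceG ⟨h, y⟩) ≤ P.lipG n * flatNorm (y - x) := by
  obtain ⟨-, hY⟩ := mem_hex.1 x.2
  have hr : 0 < P.rad n h.1 := rad_pos (Nat.cast_nonneg _)
  have hr' : P.rad n (h.1 + 1) ≤ P.ratio n * P.rad n h.1 :=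
    rad_add_one_le_ratio_mul (Nat.cast_nonneg _) le_rfl
  have hr₁ : 0 < P.rad n (h.1 + 1) := rad_pos (by positivity)
  have hratio := one_le_ratio (P := P) (n := n)
  have hdφ := dφ_pos (P := P) (n := n)
  have hYle : |side h.2.2 * x.1.2| ≤ P.dφ n / 2 * P.rad n (h.1 + 1) := by
    rw [abs_of_nonneg hY.1]
    exact hY.2.trans (mul_le_mul_of_nonneg_left (factor_mem_Icc _ _).2 half_dφ_pos.le)
  have hangle : |(P.chartG n h y - P.chartG n h x).2| ≤ |y.1.2 - x.1.2| / P.rad n h.1 +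
      P.dφ n * P.rad n (h.1 + 1) / P.rad n h.1 ^ 2 * |y.1.1 - x.1.1| := by
    rw [Prod.snd_sub, chartG, chartG, add_sub_add_left_eq_sub, ← mul_sub, abs_side_mul]
    have hmin := abs_div_divisor_sub_le (X := x.1.1) (X' := y.1.1)
      (Y' := side h.2.2 * y.1.2) hYle
    rw [← mul_sub, abs_side_mul] at hmin
    refine le_trans ?_ hmin
    simpa using abs_min_sub_min_le_max (P.dφ n / 2) (side h.2.2 * y.1.2 / P.divisor n h.1 y.1.1)
      (P.dφ n / 2) (side h.2.2 * x.1.2 / P.divisor n h.1 x.1.1)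
  have hle (z : P.hex n h) : (P.chartG n h z).1 ≤ P.rad n (h.1 + 1) :=
    col_le_iff.1 (chartG_mem_halfCell z.2).1.2
  refine (sectorDist_le _ _ (hle x) (hle y)).trans ?_
  rw [flatNorm_eq_polarNorm]
  refine polarNorm_le_of_nearly_diagonal (by linarith) (by positivity) ?_ ?_
  · simp only [pieceG, chartG, Prod.fst_sub, add_sub_add_left_eq_sub]
    exact le_mul_of_one_le_left (abs_nonneg _) hratio
  · rw [abs_mul, abs_of_pos hr₁, one_mul]
    calc P.rad n (h.1 + 1) * |(P.chartG n h y - P.chartG n h x).2|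
        ≤ P.ratio n * P.rad n h.1 * (|y.1.2 - x.1.2| / P.rad n h.1 +
            P.dφ n * (P.ratio n * P.rad n h.1) / P.rad n h.1 ^ 2 * |y.1.1 - x.1.1|) := by
          gcongr
          refine hangle.trans ?_
          gcongr
      _ = P.ratio n * |y.1.2 - x.1.2| + P.ratio n ^ 2 * P.dφ n * |y.1.1 - x.1.1| := by
          field_simp

theorem sectorDist_G_le (hD : P.D n ≤ 1 / 2) {p q : P.Surface n}
    (hpq : Reachable (P.surfaceArc n) p q) :
    P.sectorDist (G hD p) (G hD q) ≤ P.lipG n * P.surfaceDist n p q := by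
  have hlip : 0 < P.lipG n := by
    have := one_le_ratio (P := P) (n := n)
    have := dφ_pos (P := P) (n := n)
    unfold lipG
    positivity
  refine le_mul_pathDist (δ := fun p q => P.sectorDist (G hD p) (G hD q)) hlip
    (fun _ => sectorDist_self _) (fun _ _ _ => sectorDist_triangle _ _ _) ?_ hpq
  rintro _ _ L ⟨h, x, y, rfl, rfl, harc⟩
  refine harc.le_mul_of_eventually
    (δ := fun x y : P.hex n h => P.sectorDist (pieceG ⟨h, x⟩) (pieceG ⟨h, y⟩))
    isLengthElement_flatNorm (fun _ => sectorDist_self _) (fun _ _ _ => sectorDist_triangle _ _ _)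
    fun x => .of_forall fun y => ⟨sectorDist_pieceG_le x y, ?_⟩
  rw [flatNorm_sub_comm]
  exact sectorDist_pieceG_le y x

theorem abs_sub_le_of_mem_halfCell {h : Label n} {x y : ℝ × ℝ} (hx : x ∈ P.halfCell n h)
    (hy : y ∈ P.halfCell n h) : |y.2 - x.2| ≤ P.dφ n / 2 := by
  have hx' := side_mul_sub_mem_Icc.2 hx.2
  have hy' := side_mul_sub_mem_Icc.2 hy.2
  have := abs_sub_le_of_le_of_le hy'.1 hy'.2 hx'.1 hx'.2
  rwa [← mul_sub, abs_side_mul, sub_sub_sub_cancel_right, sub_zero] at this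

theorem chartG_chartF_fst (h : Label n) (x : ℝ × ℝ) :
    (P.chartG n h (P.chartF n h x)).1 = x.1 := add_sub_cancel _ _

theorem le_surfaceDist_F (hD : P.D n ≤ 1 / 2) (x y : P.sector) :
    P.sectorDist x y ≤
      P.lipG n * P.surfaceDist n (P.F n x) (P.F n y) + 2 * (P.R₁ * (P.dφ n / 2)) := by
  have hR := (R₁_pos P).le
  have hcell (z : P.sector) : (G hD (P.F n z)).1 ∈ P.halfCell n (P.label n z) :=
    chartG_mem_halfCell (P.chartF_mem n z.2)
  have hfst (z : P.sector) : (G hD (P.F n z)).1.1 = z.1.1 := chartG_chartF_fst _ _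
  have hx : P.sectorDist x (G hD (P.F n x)) ≤ P.R₁ * (P.dφ n / 2) := by
    refine (sectorDist_le_add _ _).trans ?_
    rw [hfst, sub_self, abs_zero, zero_add]
    exact mul_le_mul_of_nonneg_left (abs_sub_le_of_mem_halfCell (label_mem x.2) (hcell x)) hR
  have hy : P.sectorDist (G hD (P.F n y)) y ≤ P.R₁ * (P.dφ n / 2) := by
    refine (sectorDist_le_add _ _).trans ?_
    rw [hfst, sub_self, abs_zero, zero_add]
    exact mul_le_mul_of_nonneg_left (abs_sub_le_of_mem_halfCell (hcell y) (label_mem y.2)) hR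
  have hxy := sectorDist_G_le hD (reachable_F hD x y)
  linarith [sectorDist_triangle x (G hD (P.F n x)) y,
    sectorDist_triangle (G hD (P.F n x)) (G hD (P.F n y)) y]

end Params

/-! ### The distortion -/

theorem abs_sub_le_of_affine_bounds {d d' M K A L B : ℝ} (hd : d ≤ M) (hK : 1 ≤ K)
    (h : d' ≤ K * d + A) (hL : 1 ≤ L) (h' : d ≤ L * d' + B) :
    |d - d'| ≤ max ((K - 1) * M + A) ((L - 1) * M + B) := by
  rcases le_total d d' with hle | hle
  · have := mul_le_mul_of_nonneg_left hd (sub_nonneg.2 hK)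
    rw [abs_sub_comm, abs_of_nonneg (sub_nonneg.2 hle)]
    exact le_max_of_le_left (by linarith)
  · have := mul_le_mul_of_nonneg_left (hle.trans hd) (sub_nonneg.2 hL)
    rw [abs_of_nonneg (sub_nonneg.2 hle)]
    exact le_max_of_le_right (by linarith)

namespace Params

variable {P : Params} {n : ℕ+}

theorem one_le_lipF : 1 ≤ P.lipF n := by
  have hroot := root_pos (P := P) (n := n)
  have := mul_pos (tan_pos P) hroot
  have := one_le_mul_of_one_le_of_one_le (le_add_of_nonneg_right hroot.le)
    (one_le_ratio (P := P) (n := n))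
  unfold lipF
  linarith

theorem one_le_lipG : 1 ≤ P.lipG n :=
  one_le_ratio.trans (le_add_of_nonneg_right (mul_nonneg (sq_nonneg _) dφ_pos.le))

theorem distortion_le (hD : P.D n ≤ 1 / 2) : P.distortion n ≤ ENNReal.ofReal
    (max ((P.lipF n - 1) * (P.b + P.R₁ * (P.ε / P.b)) + 2 * P.hexDiam n)
      ((P.lipG n - 1) * (P.b + P.R₁ * (P.ε / P.b)) + 2 * (P.R₁ * (P.dφ n / 2)))) :=
  iSup₂_le fun x y => ENNReal.ofReal_le_ofReal <| abs_sub_le_of_affine_bounds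
    (sectorDist_le_diam x y) one_le_lipF (surfaceDist_F_le hD x y) one_le_lipG
    (le_surfaceDist_F hD x y)

theorem tendsto_bCell (P : Params) : Tendsto (fun n : ℕ+ => P.bCell n) atTop (𝓝 0) :=
  (tendsto_const_div_atTop_nhds_zero_nat P.b).comp tendsto_PNat_val_atTop_atTop

theorem tendsto_dφ (P : Params) : Tendsto (fun n : ℕ+ => P.dφ n) atTop (𝓝 0) := by
  refine ((tendsto_const_div_atTop_nhds_zero_nat (P.ε / P.b)).comp
    tendsto_PNat_val_atTop_atTop).congr fun n => ?_
  rw [Function.comp_apply, ← n_mul_dφ (n := n), mul_div_cancel_left₀ _ (n_pos n).ne']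

theorem tendsto_D (P : Params) : Tendsto (fun n : ℕ+ => P.D n) atTop (𝓝 0) := by
  simpa [D] using (tendsto_dφ P).div_const (2 * Real.tan P.θ)

theorem tendsto_root (P : Params) : Tendsto (fun n : ℕ+ => P.root n) atTop (𝓝 0) := by
  simpa [root] using (tendsto_D P).sqrt

theorem tendsto_ratio (P : Params) : Tendsto (fun n : ℕ+ => P.ratio n) atTop (𝓝 1) := by
  simpa [ratio] using ((tendsto_bCell P).div_const P.R₀).const_add 1

theorem tendsto_lipF (P : Params) : Tendsto (fun n : ℕ+ => P.lipF n) atTop (𝓝 1) := by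
  simpa [lipF] using (((tendsto_root P).const_add 1).mul (tendsto_ratio P)).add
    ((tendsto_root P).const_mul (Real.tan P.θ))

theorem tendsto_lipG (P : Params) : Tendsto (fun n : ℕ+ => P.lipG n) atTop (𝓝 1) := by
  simpa [lipG] using (tendsto_ratio P).add (((tendsto_ratio P).pow 2).mul (tendsto_dφ P))

theorem tendsto_hexDiam (P : Params) : Tendsto (fun n : ℕ+ => P.hexDiam n) atTop (𝓝 0) := by
  simpa [hexDiam] using
    ((tendsto_bCell P).add (((tendsto_dφ P).div_const 2).mul_const P.R₁)).const_mul 2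

theorem tendsto_distortion (P : Params) :
    Tendsto (fun n : ℕ+ => P.distortion n) atTop (𝓝 0) := by
  have hF := (((tendsto_lipF P).sub_const 1).mul_const (P.b + P.R₁ * (P.ε / P.b))).add
    ((tendsto_hexDiam P).const_mul 2)
  have hG := (((tendsto_lipG P).sub_const 1).mul_const (P.b + P.R₁ * (P.ε / P.b))).add
    ((((tendsto_dφ P).div_const 2).const_mul P.R₁).const_mul 2)
  have hlim := ENNReal.tendsto_ofReal (hF.max hG)
  simp only [sub_self, zero_mul, zero_div, mul_zero, add_zero, max_self,
    ENNReal.ofReal_zero] at hlim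
  refine tendsto_of_tendsto_of_tendsto_of_le_of_le' tendsto_const_nhds hlim
    (.of_forall fun _ => zero_le) ?_
  filter_upwards [(tendsto_D P).eventually_le_const (by norm_num : (0 : ℝ) < 1 / 2)] with n hD
  exact distortion_le hD

end Params

/-! ### The differential -/

/-- The matrix `diag (1, r)`, which maps the orthonormal frame `∂_r, r⁻¹ ∂_φ` of the polar
coordinates to the standard basis. -/
def polarFrame (r : ℝ) : ℝ × ℝ →L[ℝ] ℝ × ℝ :=
  (ContinuousLinearMap.fst ℝ ℝ ℝ).prod (r • ContinuousLinearMap.snd ℝ ℝ ℝ)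

theorem polarFrame_mem_SO {x : ℝ × ℝ} (hx : 0 < x.1) : polarFrame x.1 ∈ SO x := by
  refine ⟨fun v => by simp [flatNorm, polarNorm, polarFrame, mul_pow], ?_⟩
  have : (polarFrame x.1 : ℝ × ℝ →ₗ[ℝ] ℝ × ℝ) =
      LinearMap.prodMap LinearMap.id (x.1 • LinearMap.id) := by
    ext <;> simp [polarFrame]
  rw [ContinuousLinearMap.det, this, LinearMap.det_prodMap]
  simpa using hx

theorem polarNorm_pos {x v : ℝ × ℝ} (hx : 0 < x.1) (hv : v ≠ 0) : 0 < polarNorm x v := by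
  refine Real.sqrt_pos.2 ?_
  rcases eq_or_ne v.1 0 with h | h
  · have : v.2 ≠ 0 := fun h' => hv (Prod.ext h h')
    positivity
  · positivity

theorem opNorm_nonneg (x : ℝ × ℝ) (A : ℝ × ℝ →L[ℝ] ℝ × ℝ) : 0 ≤ opNorm x A := by
  refine Real.sSup_nonneg ?_
  rintro _ ⟨v, -, rfl⟩
  exact div_nonneg (flatNorm_nonneg _) (polarNorm_nonneg _ _)

theorem opNorm_le {x : ℝ × ℝ} (hx : 0 < x.1) {A : ℝ × ℝ →L[ℝ] ℝ × ℝ} {c : ℝ} (hc : 0 ≤ c)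
    (h : ∀ v, flatNorm (A v) ≤ c * polarNorm x v) : opNorm x A ≤ c := by
  refine Real.sSup_le ?_ hc
  rintro _ ⟨v, hv, rfl⟩
  exact (div_le_iff₀ (polarNorm_pos hx hv)).2 (h v)

theorem distSO_le_opNorm_sub {x : ℝ × ℝ} {A Q : ℝ × ℝ →L[ℝ] ℝ × ℝ} (hQ : Q ∈ SO x) :
    distSO x A ≤ opNorm x (A - Q) := by
  refine csInf_le ⟨0, ?_⟩ ⟨Q, hQ, rfl⟩
  rintro _ ⟨Q, -, rfl⟩
  exact opNorm_nonneg _ _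

namespace Params

variable {P : Params} {n : ℕ+}

/-- The closed middle zone of the `i`-th column, as an interval of radii. -/
def zone (P : Params) (n : ℕ+) (i : ℕ) : Set ℝ :=
  Icc (P.rad n (i + 1 / 2 - P.D n / 2)) (P.rad n (i + 1 / 2 + P.D n / 2))

theorem lipschitzWith_factor (i : ℕ) : LipschitzWith (P.D n)⁻¹.toNNReal (P.factor n i) := by
  refine LipschitzWith.of_dist_le' fun r r' => ?_
  rw [Real.dist_eq, Real.dist_eq, factor_eq_rad, factor_eq_rad, inv_mul_eq_div]
  exact abs_rad_ramp_sub_le D_pos i r' r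

theorem deriv_factor_of_notMem {i : ℕ} {r : ℝ} (h : r ∉ P.zone n i) :
    deriv (P.factor n i) r = 0 := by
  have hle : P.rad n (i + 1 / 2 - P.D n / 2) ≤ P.rad n (i + 1 / 2 + P.D n / 2) :=
    rad_le_rad_iff.2 (by linarith [D_pos (P := P) (n := n)])
  rw [zone, mem_Icc, not_and_or, not_le, not_le] at h
  rcases h with h | h
  · have : P.factor n i =ᶠ[𝓝 r] fun _ => P.rad n i := by
      filter_upwards [Iio_mem_nhds h] with s hs using if_pos hs.le
    rw [this.deriv_eq, deriv_const]
  · have : P.factor n i =ᶠ[𝓝 r] fun _ => P.rad n (i + 1) := by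
      filter_upwards [Ioi_mem_nhds h] with s hs
      exact (if_neg (hle.trans_lt hs).not_ge).trans (if_neg (not_le_of_gt hs))
    rw [this.deriv_eq, deriv_const]

theorem half_dφ_mul_abs_deriv_factor_le (i : ℕ) (r : ℝ) :
    P.dφ n / 2 * |deriv (P.factor n i) r| ≤
      (P.zone n i).indicator (fun _ => Real.tan P.θ) r := by
  by_cases h : r ∈ P.zone n i
  · have hD := D_pos (P := P) (n := n)
    have := norm_deriv_le_of_lipschitz (lipschitzWith_factor (P := P) (n := n) i) (x₀ := r)
    rw [Real.norm_eq_abs, Real.coe_toNNReal _ (inv_pos.2 hD).le] at this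
    calc P.dφ n / 2 * |deriv (P.factor n i) r|
        ≤ P.dφ n / 2 * (P.D n)⁻¹ := mul_le_mul_of_nonneg_left this half_dφ_pos.le
      _ = Real.tan P.θ := by rw [half_dφ_eq, mul_inv_cancel_right₀ hD.ne']
      _ = (P.zone n i).indicator (fun _ => Real.tan P.θ) r :=
        (indicator_of_mem h fun _ => Real.tan P.θ).symm
  · rw [indicator_of_notMem h, deriv_factor_of_notMem h, abs_zero, mul_zero]

theorem fderiv_chartF {h : Label n} {x : ℝ × ℝ}
    (hf : DifferentiableAt ℝ (P.factor n h.1) x.1) (v : ℝ × ℝ) :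
    fderiv ℝ (P.chartF n h) x v = (v.1, P.factor n h.1 x.1 * v.2 +
      (x.2 - P.baseAngle n h) * (deriv (P.factor n h.1) x.1 * v.1)) := by
  have h₁ : HasFDerivAt (fun y : ℝ × ℝ => P.factor n h.1 y.1)
      (deriv (P.factor n h.1) x.1 • ContinuousLinearMap.fst ℝ ℝ ℝ) x :=
    hf.hasDerivAt.comp_hasFDerivAt x hasFDerivAt_fst
  have h₂ : HasFDerivAt (fun y : ℝ × ℝ => y.2 - P.baseAngle n h)
      (ContinuousLinearMap.snd ℝ ℝ ℝ) x := hasFDerivAt_snd.sub_const _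
  have : HasFDerivAt (P.chartF n h) _ x := (hasFDerivAt_fst.sub_const _).prodMk (h₂.mul h₁)
  rw [this.fderiv]
  simp [add_comm]

theorem abs_factor_sub_le {h : Label n} {x : ℝ × ℝ} (hx : x ∈ P.halfCell n h) :
    |P.factor n h.1 x.1 - x.1| ≤ P.bCell n / P.R₀ * |x.1| := by
  have hR := R₀_pos P
  have hRx : P.R₀ ≤ x.1 := (halfCell_subset_sector h hx).1.1
  have hfac := factor_mem_Icc (P := P) (n := n) h.1 x.1
  calc |P.factor n h.1 x.1 - x.1| ≤ P.rad n (h.1 + 1) - P.rad n h.1 :=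
        abs_sub_le_of_le_of_le hfac.1 hfac.2 (le_col_iff.1 hx.1.1) (col_le_iff.1 hx.1.2)
    _ = P.bCell n / P.R₀ * P.R₀ := by
        rw [rad_sub_rad, add_sub_cancel_left, one_mul, div_mul_cancel₀ _ hR.ne']
    _ ≤ P.bCell n / P.R₀ * |x.1| :=
        mul_le_mul_of_nonneg_left (hRx.trans (le_abs_self _)) (div_pos bCell_pos hR).le

theorem distSO_fderiv_chartF_le {h : Label n} {x : ℝ × ℝ} (hx : x ∈ P.halfCell n h)
    (hf : DifferentiableAt ℝ (P.factor n h.1) x.1) :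
    distSO x (fderiv ℝ (P.chartF n h) x) ≤
      P.bCell n / P.R₀ + P.dφ n / 2 * |deriv (P.factor n h.1) x.1| := by
  have hb := bCell_pos (P := P) (n := n)
  have hd := dφ_pos (P := P) (n := n)
  have hR := R₀_pos P
  have hx₀ := fst_pos_of_mem_sector (halfCell_subset_sector h hx)
  have hfx := abs_factor_sub_le hx
  refine (distSO_le_opNorm_sub (polarFrame_mem_SO hx₀)).trans
    (opNorm_le hx₀ (by positivity) fun v => ?_)
  have e : (fderiv ℝ (P.chartF n h) x - polarFrame x.1) v =
      (0, (P.factor n h.1 x.1 - x.1) * v.2 +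
        (x.2 - P.baseAngle n h) * (deriv (P.factor n h.1) x.1 * v.1)) := by
    rw [sub_apply, fderiv_chartF hf]
    ext <;> simp [polarFrame]
    ring
  rw [e, flatNorm_eq_polarNorm]
  refine polarNorm_le_of_nearly_diagonal (by positivity) (by positivity)
    (abs_zero.trans_le (by positivity)) ?_
  rw [one_mul]
  refine (abs_add_le _ _).trans (add_le_add ?_ ?_)
  · rw [abs_mul, abs_mul, ← mul_assoc]
    gcongr
  · rw [abs_mul, abs_mul, ← mul_assoc]
    gcongr
    exact abs_sub_baseAngle_le hx

/-- The part of the plane over the middle zones of the columns. -/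
def strips (P : Params) (n : ℕ+) : Set (ℝ × ℝ) := ⋃ i : Fin n, Prod.fst ⁻¹' P.zone n i

theorem measurableSet_strips : MeasurableSet (P.strips n) :=
  .iUnion fun _ => measurable_fst measurableSet_Icc

theorem distSO_dF_le {x : ℝ × ℝ} (hx : x ∈ P.sector)
    (hf : ∀ i, DifferentiableAt ℝ (P.factor n i) x.1) :
    distSO x (P.dF n x) ≤ P.bCell n / P.R₀ + (P.strips n).indicator (fun _ => Real.tan P.θ) x := by
  refine (distSO_fderiv_chartF_le (label_mem hx) (hf _)).trans (add_le_add_right ?_ _)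
  refine (half_dφ_mul_abs_deriv_factor_le _ _).trans ?_
  exact indicator_le_indicator_of_subset (s := Prod.fst ⁻¹' P.zone n (P.label n x).1)
    (f := fun _ => Real.tan P.θ)
    (subset_iUnion (fun i : Fin n => Prod.fst ⁻¹' P.zone n i) _) (fun _ => (tan_pos P).le) x

theorem ae_mem_sector_and_differentiableAt_factor (P : Params) (n : ℕ+) :
    ∀ᵐ x ∂P.sectorVol, x ∈ P.sector ∧ ∀ i, DifferentiableAt ℝ (P.factor n i) x.1 := by
  have hf : ∀ᵐ r, ∀ i, DifferentiableAt ℝ (P.factor n i) r :=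
    ae_all_iff.2 fun i => (lipschitzWith_factor i).ae_differentiableAt_of_real
  refine (withDensity_absolutelyContinuous _ _).ae_le ?_
  exact (ae_restrict_mem (measurableSet_Icc.prod measurableSet_Icc)).and
    (ae_restrict_of_ae (Measure.quasiMeasurePreserving_fst.ae hf))

theorem sectorVol_apply_le {T : Set (ℝ × ℝ)} (hT : MeasurableSet T) :
    P.sectorVol T ≤ ENNReal.ofReal P.R₁ * volume (T ∩ P.sector) := by
  unfold sectorVol
  rw [withDensity_apply _ hT, Measure.restrict_restrict hT, ← setLIntegral_const]
  exact setLIntegral_mono measurable_const fun x hx => ENNReal.ofReal_le_ofReal hx.2.1.2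

theorem sectorVol_univ_ne_top : P.sectorVol univ ≠ ⊤ := by
  refine ne_top_of_le_ne_top (ENNReal.mul_ne_top ENNReal.ofReal_ne_top ?_)
    (sectorVol_apply_le MeasurableSet.univ)
  rw [univ_inter]
  exact (isCompact_Icc.prod isCompact_Icc).measure_ne_top

theorem volume_zone_prod (i : ℕ) : volume (P.zone n i ×ˢ Icc 0 (P.ε / P.b)) =
    ENNReal.ofReal (P.D n * P.bCell n * (P.ε / P.b)) := by
  rw [Measure.volume_eq_prod, Measure.prod_prod, zone, Real.volume_Icc, Real.volume_Icc,
    rad_sub_rad, add_sub_sub_cancel, add_halves, sub_zero,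
    ← ENNReal.ofReal_mul (mul_pos D_pos bCell_pos).le]

theorem volume_strips_inter_sector_le :
    volume (P.strips n ∩ P.sector) ≤ ENNReal.ofReal (P.D n * P.ε) := by
  have hb := P.b_pos.ne'
  have hsub : P.strips n ∩ P.sector ⊆ ⋃ i : Fin n, P.zone n i ×ˢ Icc 0 (P.ε / P.b) := by
    rw [strips, iUnion_inter]
    exact iUnion_mono fun i x hx => ⟨hx.1, hx.2.2⟩
  calc volume (P.strips n ∩ P.sector)
      ≤ ∑ i : Fin n, volume (P.zone n i ×ˢ Icc 0 (P.ε / P.b)) :=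
        (measure_mono hsub).trans (measure_iUnion_fintype_le _ _)
    _ = ENNReal.ofReal (P.D n * ((n : ℕ) * P.bCell n) * (P.ε / P.b)) := by
        simp only [volume_zone_prod]
        rw [Finset.sum_const, Finset.card_univ, Fintype.card_fin, ← ENNReal.ofReal_nsmul,
          nsmul_eq_mul]
        ring_nf
    _ = ENNReal.ofReal (P.D n * P.ε) := by
        rw [n_mul_bCell]
        field_simp

theorem lintegral_distSO_le {p : ℝ} (hp : 0 ≤ p) :
    ∫⁻ x, ENNReal.ofReal (distSO x (P.dF n x)) ^ p ∂P.sectorVol ≤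
      ENNReal.ofReal (P.bCell n / P.R₀) ^ p * P.sectorVol univ +
      ENNReal.ofReal (P.bCell n / P.R₀ + Real.tan P.θ) ^ p *
        (ENNReal.ofReal P.R₁ * ENNReal.ofReal (P.D n * P.ε)) := by
  set c := ENNReal.ofReal (P.bCell n / P.R₀)
  set C := ENNReal.ofReal (P.bCell n / P.R₀ + Real.tan P.θ)
  calc ∫⁻ x, ENNReal.ofReal (distSO x (P.dF n x)) ^ p ∂P.sectorVol
      ≤ ∫⁻ x, (c ^ p + (P.strips n).indicator (fun _ => C ^ p) x) ∂P.sectorVol := by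
        refine lintegral_mono_ae ?_
        filter_upwards [ae_mem_sector_and_differentiableAt_factor P n] with x ⟨hx, hf⟩
        have h := ENNReal.rpow_le_rpow (ENNReal.ofReal_le_ofReal (distSO_dF_le hx hf)) hp
        by_cases hs : x ∈ P.strips n
        · rw [indicator_of_mem hs] at h ⊢
          exact h.trans le_add_self
        · rwa [indicator_of_notMem hs, add_zero] at h ⊢
    _ = c ^ p * P.sectorVol univ + C ^ p * P.sectorVol (P.strips n) := by
        rw [lintegral_add_left measurable_const, lintegral_const,
          lintegral_indicator_const measurableSet_strips]
    _ ≤ c ^ p * P.sectorVol univ +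
          C ^ p * (ENNReal.ofReal P.R₁ * ENNReal.ofReal (P.D n * P.ε)) := by
        gcongr
        exact (sectorVol_apply_le measurableSet_strips).trans
          (mul_le_mul_right volume_strips_inter_sector_le _)

theorem tendsto_lintegral_distSO (P : Params) {p : ℝ} (hp : 0 < p) :
    Tendsto (fun n : ℕ+ => ∫⁻ x, ENNReal.ofReal (distSO x (P.dF n x)) ^ p ∂P.sectorVol)
      atTop (𝓝 0) := by
  have hb : Tendsto (fun n : ℕ+ => P.bCell n / P.R₀) atTop (𝓝 0) := by
    simpa using (tendsto_bCell P).div_const P.R₀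
  have hoff : Tendsto (fun n : ℕ+ => ENNReal.ofReal (P.bCell n / P.R₀) ^ p * P.sectorVol univ)
      atTop (𝓝 0) := by
    simpa [hp] using ENNReal.Tendsto.mul_const ((ENNReal.tendsto_ofReal hb).ennrpow_const p)
      (.inr sectorVol_univ_ne_top)
  have hvol : Tendsto (fun n : ℕ+ => ENNReal.ofReal P.R₁ * ENNReal.ofReal (P.D n * P.ε))
      atTop (𝓝 0) := by
    simpa using ENNReal.Tendsto.const_mul
      (ENNReal.tendsto_ofReal ((tendsto_D P).mul_const P.ε)) (.inr ENNReal.ofReal_ne_top)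
  have hon := ENNReal.Tendsto.mul
    ((ENNReal.tendsto_ofReal (hb.add_const (Real.tan P.θ))).ennrpow_const p)
    (.inr ENNReal.zero_ne_top) hvol
    (.inr (ENNReal.rpow_ne_top_of_nonneg hp.le ENNReal.ofReal_ne_top))
  have hlim := hoff.add hon
  rw [mul_zero, add_zero] at hlim
  exact tendsto_of_tendsto_of_tendsto_of_le_of_le tendsto_const_nhds hlim (fun _ => zero_le)
    fun n => lintegral_distSO_le hp.le

end Params

end EdgeDislocation

end

theorem proposition3p1_general (P : EdgeDislocation.Params) :
    Tendsto (fun n : ℕ+ => P.distortion n) atTop (𝓝 0) ∧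
    ∀ p : ℝ, 0 < p →
      Tendsto
        (fun n : ℕ+ =>
          ∫⁻ x, ENNReal.ofReal (EdgeDislocation.distSO x (P.dF n x)) ^ p ∂P.sectorVol)
        atTop (𝓝 0) :=
  ⟨P.tendsto_distortion, fun _ => P.tendsto_lintegral_distSO⟩

theorem proposition3p1 (P : EdgeDislocation.Params) :
    Tendsto (fun n : ℕ+ => P.distortion n) atTop (𝓝 0) ∧
    ∀ p : ℝ, 1 ≤ p →
      Tendsto
        (fun n : ℕ+ =>
          ∫⁻ x, ENNReal.ofReal (EdgeDislocation.distSO x (P.dF n x)) ^ p ∂P.sectorVol)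
        atTop (𝓝 0) :=
  ⟨(proposition3p1_general P).1,
    fun p hp => (proposition3p1_general P).2 p (zero_lt_one.trans_le hp)⟩
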